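/- Let $N\ge 2$, $\mathbf p\in[2,\infty)$, $s\in(\frac12,1)$. Let $\alpha_{\mathbf p}\in(0,\frac\pi2]$ be the angle such that the spherical cap $A_{\mathbf p}=\{|z|=1,\ \angle(e_1,z)<\alpha_{\mathbf p}\}$ satisfies $\mathbf p-1=\int_{A_{\mathbf p}}\langle z,e_1\rangle^2\,d\sigma\big/\int_{A_{\mathbf p}}\langle z,e_2\rangle^2\,d\sigma$. For $a\ge 0$ and $|y|=1$ let $T^{a,\infty}(y)=\{z\in\mathbb R^N:\ \angle(y,z)<\alpha_{\mathbf p},\ |z|>a\}$, and let $d\mu(z)=C(N,s)|z|^{-N-2s}\,dz$ with $C(N,s)=\frac{4^s s\,\Gamma(\frac N2+s)}{\pi^{N/2}\Gamma(1-s)}$. For $\epsilon>0$ and a bounded Borel function $u:\mathbb R^N\to\mathbb R$ let $$\mathcal A_\epsilon u(x)=\frac12\Big(\sup_{|y|=1}\frac{1}{\mu(T^{\epsilon,\infty}(y))}\int_{T^{\epsilon,\infty}(y)}u(x+z)\,d\mu(z)+\inf_{|y|=1}\frac{1}{\mu(T^{\epsilon,\infty}(y))}\int_{T^{\epsilon,\infty}(y)}u(x+z)\,d\mu(z)\Big).$$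 For an open bounded set $\mathcal D\subset\mathbb R^N$ and a function $F:\mathbb R^N\to\mathbb R$, a solution of $(\mathrm{DPP})_\epsilon$ is a bounded Borel function $u_\epsilon:\mathbb R^N\to\mathbb R$ with $u_\epsilon=\mathcal A_\epsilon u_\epsilon$ in $\mathcal D$ and $u_\epsilon=F$ in $\mathbb R^N\setminus\mathcal D$. For a bounded Borel function $u$ that is $C^2$ in a neighbourhood of $x$ with $\nabla u(x)\ne0$ let $$\Delta_{\mathbf p}^s u(x)=\frac{2-2s}{C(N,s)}\cdot\frac{N+\mathbf p-2}{\sigma(A_{\mathbf p})}\int_{T^{0,\infty}\left(\frac{\nabla u(x)}{|\nabla u(x)|}\right)}\big(u(x+z)+u(x-z)-2u(x)\big)\,d\mu(z).$$ A bounded, uniformly continuous function $u:\mathbb R^N\to\mathbb R$ is a viscosity solution of $$\Delta_{\mathbf p}^s u=0\ \text{ in }\mathcal D,\qquad u=F\ \text{ in }\mathbb R^N\setminus\mathcal D$$ if $u=F$ in $\mathbb R^N\setminus\mathcal D$ and if, for all $x\in\mathcal D$, all $r>0$ and all $\phi\in C^2(\mathbb R^N)$ with $\phi(x)=u(x)$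 and $\nabla\phi(x)\neq0$, the function $\tilde\phi=\mathbf 1_{\bar B_r(x)}\phi+\mathbf 1_{\mathbb R^N\setminus\bar B_r(x)}u$ satisfies: (i) if $\phi>u$ on $\bar B_r(x)\setminus\{x\}$, then $\Delta_{\mathbf p}^s\tilde\phi(x)\ge0$; (ii) if $\phi<u$ on $\bar B_r(x)\setminus\{x\}$, then $\Delta_{\mathbf p}^s\tilde\phi(x)\le0$. **Corollary.** Let $\mathcal D\subset\mathbb R^N$ be open and bounded, and satisfy the exterior cone condition: there is a finite cone $C=\{z:\angle(e_1,z)<\theta,\ 0<|z|<h\}$ with $\theta,h>0$ such that for every $x\in\partial\mathcal D$ there is a rotation $S_x\in SO(N)$ with $x+S_xC\subset\mathbb R^N\setminus\mathcal D$. Let $F:\mathbb R^N\to\mathbb R$ be bounded and uniformly continuous. Let $\epsilon_n>0$ with $\epsilon_n\to0$, and for each $n$ let $u_{\epsilon_n}$ be a solution of $(\mathrm{DPP})_{\epsilon_n}$. Then there is a subsequence of $(u_{\epsilon_n})$ that converges, uniformly on $\mathbb R^N$, to a viscosity solution of $\Delta_{\mathbf p}^s u=0$ in $\mathcal D$, $u=F$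 in $\mathbb R^N\setminus\mathcal D$. -/

import Mathlib

open MeasureTheory Filter Topology Metric
open scoped ENNReal

namespace GeomPLaplace

noncomputable section

/-- The space `ℝ^N` with its Euclidean norm. -/
abbrev Rn (N : ℕ) : Type := EuclideanSpace ℝ (Fin N)

/-! ### The aperture angle -/

/-- The surface measure `σ` on the unit sphere of `ℝ^N`. -/
def surf (N : ℕ) : Measure (sphere (0 : Rn N) 1) := (volume : Measure (Rn N)).toSphere

/-- The spherical cup of unit vectors that make an angle less than `α` with `e₁`. (The coordinates
of `ℝ^N` are numbered from `0`, so `e₁` is `EuclideanSpace.single 0 1`.) -/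
def cup (N : ℕ) [NeZero N] (α : ℝ) : Set (sphere (0 : Rn N) 1) :=
  {z | InnerProductGeometry.angle (EuclideanSpace.single (0 : Fin N) (1 : ℝ)) (z : Rn N) < α}

/-- The second moment `∫ ⟨z, e⟩² dσ(z)` of the cup, where `e` is the `i`-th coordinate vector. -/
def cupMoment (N : ℕ) [NeZero N] (α : ℝ) (i : Fin N) : ℝ :=
  ∫ z in cup N α, ((z : Rn N) i) ^ 2 ∂(surf N)

/-- The defining property of the aperture angle `α_p`: it lies in `(0, π/2]` and
`p - 1 = ∫ ⟨z, e₁⟩² dσ / ∫ ⟨z, e₂⟩² dσ`, both integrals over the cup of angle `α_p`. -/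
def IsConeAngle (N : ℕ) [NeZero N] (p α : ℝ) : Prop :=
  α ∈ Set.Ioc 0 (Real.pi / 2) ∧ p - 1 = cupMoment N α 0 / cupMoment N α 1

/-- The aperture angle `α_p`. It exists for `N ≥ 2`, `p ≥ 2` (see `coneAngle_spec`), and it is the
only angle with this property, since the mean of `⟨z, e₁⟩²` over the cup strictly decreases
in the angle. -/
def coneAngle (N : ℕ) [NeZero N] (p : ℝ) : ℝ := Classical.epsilon (IsConeAngle N p)

/-! Existence of the aperture angle. -/

instance (N : ℕ) : IsFiniteMeasure (surf N) := by unfold surf; infer_instance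

instance (N : ℕ) : (surf N).IsOpenPosMeasure := by unfold surf; infer_instance

theorem continuous_coord {N : ℕ} (i : Fin N) :
    Continuous fun z : sphere (0 : Rn N) 1 => (z : Rn N) i := by fun_prop

theorem abs_coord_le {N : ℕ} (z : sphere (0 : Rn N) 1) (i : Fin N) : |(z : Rn N) i| ≤ 1 := by
  have h := PiLp.norm_apply_le (z : Rn N) i
  have hz : ‖(z : Rn N)‖ = 1 := by simp
  rw [hz] at h
  simpa using h

theorem sum_sq_coord {N : ℕ} (z : sphere (0 : Rn N) 1) : ∑ i, ((z : Rn N) i) ^ 2 = 1 := by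
  have hz : ‖(z : Rn N)‖ = 1 := by simp
  have h := EuclideanSpace.norm_sq_eq (z : Rn N)
  rw [hz] at h
  simpa using h.symm

/-- The action of a linear isometry on the unit sphere. -/
def sphereMap {N : ℕ} (f : Rn N ≃ₗᵢ[ℝ] Rn N) (z : sphere (0 : Rn N) 1) : sphere (0 : Rn N) 1 :=
  ⟨f z, by simp⟩

theorem continuous_sphereMap {N : ℕ} (f : Rn N ≃ₗᵢ[ℝ] Rn N) : Continuous (sphereMap f) := by
  unfold sphereMap
  have := f.continuous
  fun_prop

open scoped Pointwise in
theorem map_sphereMap {N : ℕ} (f : Rn N ≃ₗᵢ[ℝ] Rn N) : (surf N).map (sphereMap f) = surf N := by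
  have hm := (continuous_sphereMap f).measurable
  refine Measure.ext fun t ht => ?_
  rw [Measure.map_apply hm ht]
  unfold surf
  rw [Measure.toSphere_apply' _ ht, Measure.toSphere_apply' _ (hm ht)]
  congr 1
  have hset : (Set.Ioo (0 : ℝ) 1) • (Subtype.val '' (sphereMap f ⁻¹' t)) =
      f ⁻¹' ((Set.Ioo (0 : ℝ) 1) • (Subtype.val '' t)) := by
    ext x
    constructor
    · rintro ⟨a, ha, y, ⟨z, hz, rfl⟩, rfl⟩
      refine ⟨a, ha, f z, ⟨sphereMap f z, hz, rfl⟩, ?_⟩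
      simp
    · rintro ⟨a, ha, y, ⟨z, hz, rfl⟩, hx⟩
      refine ⟨a, ha, f.symm z, ⟨⟨f.symm z, by simp⟩, ?_, rfl⟩, ?_⟩
      · have : sphereMap f ⟨f.symm z, by simp⟩ = z := by
          apply Subtype.ext
          simp [sphereMap]
        simpa [this] using hz
      · apply f.injective
        simpa using hx
  rw [hset]
  exact (f.measurePreserving).measure_preimage_equiv (f := f.toMeasurableEquiv) _

theorem integral_sphereMap {N : ℕ} (f : Rn N ≃ₗᵢ[ℝ] Rn N) {g : sphere (0 : Rn N) 1 → ℝ}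
    (hg : Measurable g) : ∫ z, g (sphereMap f z) ∂(surf N) = ∫ z, g z ∂(surf N) := by
  conv_rhs => rw [← map_sphereMap f]
  rw [integral_map (continuous_sphereMap f).measurable.aemeasurable hg.aestronglyMeasurable]

open scoped Pointwise in
theorem level_null {N : ℕ} [NeZero N] {c : ℝ} (h0 : 0 ≤ c) (h1 : c < 1) :
    surf N {z : sphere (0 : Rn N) 1 | (z : Rn N) 0 = c} = 0 := by
  have ht : MeasurableSet {z : sphere (0 : Rn N) 1 | (z : Rn N) 0 = c} :=
    measurableSet_eq_fun (continuous_coord (N := N) 0).measurable measurable_const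
  unfold surf
  rw [Measure.toSphere_apply' _ ht]
  refine mul_eq_zero_of_right _ ?_
  set K : Set (Rn N) := {x | c * ‖x‖ < x 0} with hK
  have hKo : IsOpen K := isOpen_lt (by fun_prop) (by fun_prop)
  have hKc : Convex ℝ K := by
    intro x hx y hy a b ha hb hab
    simp only [hK, Set.mem_ofPred_eq] at hx hy ⊢
    have h := norm_add_le (a • x) (b • y)
    rw [norm_smul, norm_smul, Real.norm_of_nonneg ha, Real.norm_of_nonneg hb] at h
    have h2 : (a • x + b • y) 0 = a * x 0 + b * y 0 := by simp
    rw [h2]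
    have h3 := mul_le_mul_of_nonneg_left h h0
    rcases ha.eq_or_lt with rfl | ha'
    · have : b = 1 := by linarith
      subst this
      simpa using hy
    · have h4 := mul_lt_mul_of_pos_left hx ha'
      have h5 := mul_le_mul_of_nonneg_left hy.le hb
      nlinarith
  refine measure_mono_null ?_ (hKc.addHaar_frontier (volume : Measure (Rn N)))
  rintro x ⟨a, ha, y, ⟨z, hz, rfl⟩, rfl⟩
  simp only [Set.mem_ofPred_eq] at hz
  have hzn : ‖(z : Rn N)‖ = 1 := by simp
  have hx : c * ‖a • (z : Rn N)‖ = (a • (z : Rn N)) 0 := by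
    rw [norm_smul, hzn, Real.norm_of_nonneg ha.1.le]
    simp [hz, mul_comm]
  change a • (z : Rn N) ∈ frontier K
  generalize a • (z : Rn N) = x at hx
  rw [hKo.frontier_eq]
  refine ⟨?_, by simp [hK, hx]⟩
  set e : Rn N := EuclideanSpace.single 0 1 with he
  have htend : Tendsto (fun t : ℝ => x + t • e) (𝓝[>] 0) (𝓝 x) := by
    have : Continuous fun t : ℝ => x + t • e := by fun_prop
    have h := this.tendsto 0
    simp only [zero_smul, add_zero] at h
    exact h.mono_left nhdsWithin_le_nhds
  refine mem_closure_of_tendsto htend ?_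
  filter_upwards [self_mem_nhdsWithin] with t ht
  have ht' : 0 < t := ht
  simp only [hK, Set.mem_ofPred_eq]
  have h := norm_add_le x (t • e)
  have hen : ‖e‖ = 1 := by simp [he]
  rw [norm_smul, hen, Real.norm_of_nonneg ht'.le] at h
  have h2 : (x + t • e) 0 = x 0 + t := by simp [he]
  rw [h2]
  nlinarith

theorem measurable_coord {N : ℕ} (i : Fin N) :
    Measurable fun z : sphere (0 : Rn N) 1 => (z : Rn N) i := (continuous_coord i).measurable

theorem coord_integrable {N : ℕ} {g : sphere (0 : Rn N) 1 → ℝ} (hg : Measurable g) {B : ℝ}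
    (hB : ∀ z, |g z| ≤ B) : Integrable g (surf N) :=
  Integrable.of_bound hg.aestronglyMeasurable B (Eventually.of_forall hB)

theorem sq_coord_le {N : ℕ} (z : sphere (0 : Rn N) 1) (i : Fin N) : ((z : Rn N) i) ^ 2 ≤ 1 := by
  have h := abs_coord_le z i
  rw [← sq_abs]
  nlinarith [abs_nonneg ((z : Rn N) i)]

theorem half_moment_eq {N : ℕ} [NeZero N] :
    ∫ z, {z : sphere (0 : Rn N) 1 | 0 < (z : Rn N) 0}.indicator
        (fun z => ((z : Rn N) 0) ^ 2) z ∂(surf N) =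
      ∫ z, {z : sphere (0 : Rn N) 1 | 0 < (z : Rn N) 0}.indicator
        (fun z => ((z : Rn N) 1) ^ 2) z ∂(surf N) := by
  have key : ∀ i j : Fin N, surf N {z : sphere (0 : Rn N) 1 | (z : Rn N) i = 0} = 0 →
      2 * ∫ z, {z : sphere (0 : Rn N) 1 | 0 < (z : Rn N) i}.indicator
        (fun z => ((z : Rn N) j) ^ 2) z ∂(surf N) = ∫ z, ((z : Rn N) j) ^ 2 ∂(surf N) := by
    intro i j hnull
    set g := {z : sphere (0 : Rn N) 1 | 0 < (z : Rn N) i}.indicator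
        (fun z => ((z : Rn N) j) ^ 2) with hg
    have hgm : Measurable g := ((measurable_coord j).pow_const 2).indicator
      (measurableSet_lt measurable_const (measurable_coord i))
    have hgb : ∀ z, |g z| ≤ 1 := by
      intro z
      simp only [hg, Set.indicator_apply]
      split_ifs
      · rw [abs_of_nonneg (sq_nonneg _)]; exact sq_coord_le z j
      · simp
    have hgi := coord_integrable hgm hgb
    have h1 := integral_sphereMap (LinearIsometryEquiv.neg ℝ (E := Rn N)) hgm
    have hgi' : Integrable (fun z => g (sphereMap (LinearIsometryEquiv.neg ℝ (E := Rn N)) z))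
        (surf N) :=
      coord_integrable (hgm.comp (continuous_sphereMap _).measurable) fun z => hgb _
    rw [two_mul]
    nth_rewrite 2 [← h1]
    rw [← integral_add hgi hgi']
    refine integral_congr_ae ?_
    have : ∀ᵐ z : sphere (0 : Rn N) 1 ∂(surf N), (z : Rn N) i ≠ 0 := by
      rw [ae_iff]; simpa using hnull
    filter_upwards [this] with z hz
    have hgz : ∀ w : sphere (0 : Rn N) 1,
        g w = if 0 < (w : Rn N) i then ((w : Rn N) j) ^ 2 else 0 := fun w => by
      simp only [hg, Set.indicator_apply, Set.mem_ofPred_eq]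
    have hneg : ∀ l, (sphereMap (LinearIsometryEquiv.neg ℝ (E := Rn N)) z : Rn N) l =
        -(z : Rn N) l := fun l => rfl
    rw [hgz, hgz, hneg, hneg]
    rcases lt_or_gt_of_ne hz with h | h
    · rw [if_neg (by linarith), if_pos (by linarith)]; ring
    · rw [if_pos h, if_neg (by linarith)]; ring
  set f : Rn N ≃ₗᵢ[ℝ] Rn N :=
    LinearIsometryEquiv.piLpCongrLeft 2 ℝ ℝ (Equiv.swap (0 : Fin N) 1) with hf
  have hf0 : ∀ z : Rn N, f z 0 = z 1 := by
    intro z; simp [hf, LinearIsometryEquiv.piLpCongrLeft_apply, Equiv.piCongrLeft'_apply]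
  have hf1 : ∀ z : Rn N, f z 1 = z 0 := by
    intro z; simp [hf, LinearIsometryEquiv.piLpCongrLeft_apply, Equiv.piCongrLeft'_apply]
  have hn0 : surf N {z : sphere (0 : Rn N) 1 | (z : Rn N) 0 = 0} = 0 := level_null le_rfl one_pos
  have k1 := key 0 0 hn0
  have k2 := key 0 1 hn0
  have k3 := integral_sphereMap f ((measurable_coord (N := N) 0).pow_const 2)
  simp only [sphereMap, hf0] at k3
  linarith

theorem cup_arccos {N : ℕ} [NeZero N] {c : ℝ} (h0 : 0 ≤ c) (h1 : c ≤ 1) :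
    cup N (Real.arccos c) = {z : sphere (0 : Rn N) 1 | c < (z : Rn N) 0} := by
  ext z
  have hz : ‖(z : Rn N)‖ = 1 := by simp
  have hb := abs_le.1 (abs_coord_le z 0)
  have : InnerProductGeometry.angle (EuclideanSpace.single (0 : Fin N) (1 : ℝ)) (z : Rn N) =
      Real.arccos ((z : Rn N) 0) := by
    unfold InnerProductGeometry.angle
    simp [hz, EuclideanSpace.inner_single_left]
  simp only [cup, Set.mem_ofPred_eq, this]
  exact Real.strictAntiOn_arccos.lt_iff_gt ⟨hb.1, hb.2⟩ ⟨by linarith, h1⟩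

theorem exists_isConeAngle {N : ℕ} [NeZero N] (hN : 2 ≤ N) {p : ℝ} (hp : 2 ≤ p) :
    ∃ α, IsConeAngle N p α := by
  have h01 : (0 : Fin N) ≠ 1 := by
    intro h
    have := congrArg Fin.val h
    rw [Fin.val_zero, Fin.val_one', Nat.mod_eq_of_lt (by omega)] at this
    omega
  set q : sphere (0 : Rn N) 1 → ℝ :=
    fun z => ((z : Rn N) 0) ^ 2 - (p - 1) * ((z : Rn N) 1) ^ 2 with hq
  have hqm : Measurable q :=
    ((measurable_coord 0).pow_const 2).sub (((measurable_coord 1).pow_const 2).const_mul _)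
  have hqb : ∀ z, |q z| ≤ p := by
    intro z
    have ha := sq_coord_le z 0
    have hb := sq_coord_le z 1
    have ha' := sq_nonneg ((z : Rn N) 0)
    have hb' := sq_nonneg ((z : Rn N) 1)
    simp only [hq, abs_le]
    constructor <;> nlinarith
  have hAm : ∀ c : ℝ, MeasurableSet {z : sphere (0 : Rn N) 1 | c < (z : Rn N) 0} := fun c =>
    measurableSet_lt measurable_const (measurable_coord 0)
  set G : ℝ → ℝ := fun c =>
    ∫ z, {z : sphere (0 : Rn N) 1 | c < (z : Rn N) 0}.indicator q z ∂(surf N) with hG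
  set c₀ : ℝ := Real.sqrt ((p - 1) / p) with hc₀
  have hfrac : (p - 1) / p < 1 := by rw [div_lt_one (by linarith)]; linarith
  have hfrac0 : 0 ≤ (p - 1) / p := div_nonneg (by linarith) (by linarith)
  have hc₀0 : 0 ≤ c₀ := Real.sqrt_nonneg _
  have hc₀1 : c₀ < 1 := by
    rw [hc₀, Real.sqrt_lt' one_pos]; simpa using hfrac
  have hc₀s : c₀ ^ 2 * p = p - 1 := by
    rw [hc₀, Real.sq_sqrt hfrac0]; field_simp
  have hcont : ContinuousOn G (Set.Icc 0 c₀) := by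
    intro c hc
    refine continuousWithinAt_of_dominated (bound := fun _ => p) ?_ ?_ (integrable_const _) ?_
    · exact Eventually.of_forall fun d => (hqm.indicator (hAm d)).aestronglyMeasurable
    · refine Eventually.of_forall fun d => Eventually.of_forall fun z => ?_
      rw [Set.indicator_apply]
      split_ifs
      · exact hqb z
      · simp; linarith
    · have : ∀ᵐ z : sphere (0 : Rn N) 1 ∂(surf N), (z : Rn N) 0 ≠ c := by
        rw [ae_iff]; simpa using level_null (N := N) hc.1 (hc.2.trans_lt hc₀1)
      filter_upwards [this] with z hz
      refine ContinuousAt.continuousWithinAt ?_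
      rcases lt_or_gt_of_ne hz with h | h
      · refine (continuousAt_const (y := (0 : ℝ))).congr ?_
        filter_upwards [lt_mem_nhds h] with d hd
        rw [Set.indicator_of_notMem]
        simp only [Set.mem_ofPred_eq]; linarith
      · refine (continuousAt_const (y := q z)).congr ?_
        filter_upwards [gt_mem_nhds h] with d hd
        rw [Set.indicator_of_mem]
        exact hd
  have hm : ∀ (c : ℝ) (i : Fin N), Integrable
      ({z : sphere (0 : Rn N) 1 | c < (z : Rn N) 0}.indicator fun z => ((z : Rn N) i) ^ 2)
      (surf N) := fun c i =>
    (coord_integrable ((measurable_coord i).pow_const 2) (B := 1) fun z => by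
      rw [abs_of_nonneg (sq_nonneg _)]; exact sq_coord_le z i).indicator (hAm c)
  set m : ℝ → Fin N → ℝ := fun c i => ∫ z, {z : sphere (0 : Rn N) 1 | c < (z : Rn N) 0}.indicator
    (fun z => ((z : Rn N) i) ^ 2) z ∂(surf N) with hmdef
  have hsplit : ∀ c, G c = m c 0 - (p - 1) * m c 1 := by
    intro c
    simp only [hG, hmdef]
    rw [← integral_const_mul, ← integral_sub (hm c 0) ((hm c 1).const_mul _)]
    refine integral_congr_ae (Eventually.of_forall fun z => ?_)
    simp only [Set.indicator_apply, hq]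
    split_ifs <;> ring
  have hG0 : G 0 ≤ 0 := by
    have h1 : m 0 0 = m 0 1 := half_moment_eq
    have h2 : 0 ≤ m 0 1 := integral_nonneg fun z =>
      Set.indicator_nonneg (fun _ _ => sq_nonneg _) z
    rw [hsplit, h1]
    nlinarith
  have hG1 : 0 ≤ G c₀ := by
    refine integral_nonneg fun z => Set.indicator_nonneg (fun z hz => ?_) z
    simp only [Set.mem_ofPred_eq] at hz
    have h2 : ((z : Rn N) 0) ^ 2 + ((z : Rn N) 1) ^ 2 ≤ 1 := by
      refine le_of_le_of_eq ?_ (sum_sq_coord z)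
      rw [← Finset.sum_pair (f := fun i => ((z : Rn N) i) ^ 2) h01]
      exact Finset.sum_le_sum_of_subset_of_nonneg (Finset.subset_univ _)
        fun _ _ _ => sq_nonneg _
    have h3 : c₀ ^ 2 ≤ ((z : Rn N) 0) ^ 2 := by gcongr
    simp only [hq]
    nlinarith
  obtain ⟨c, hc, hGc⟩ := intermediate_value_Icc hc₀0 hcont ⟨hG0, hG1⟩
  have hc1 : c < 1 := hc.2.trans_lt hc₀1
  have hmom : ∀ i, cupMoment N (Real.arccos c) i = m c i := by
    intro i
    simp only [cupMoment, hmdef]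
    rw [cup_arccos hc.1 hc1.le, integral_indicator (hAm c)]
  have hpos : 0 < m c 0 := by
    rw [hmdef, integral_pos_iff_support_of_nonneg
      (fun z => Set.indicator_nonneg (fun _ _ => sq_nonneg _) z) (hm c 0)]
    have hsub : {z : sphere (0 : Rn N) 1 | c < (z : Rn N) 0} ⊆ Function.support
        ({z : sphere (0 : Rn N) 1 | c < (z : Rn N) 0}.indicator
          fun z => ((z : Rn N) 0) ^ 2) := by
      intro z hz
      rw [Function.mem_support, Set.indicator_of_mem hz]
      have : 0 < (z : Rn N) 0 := hc.1.trans_lt hz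
      positivity
    refine lt_of_lt_of_le ?_ (measure_mono hsub)
    refine IsOpen.measure_pos _ (isOpen_lt continuous_const (continuous_coord 0)) ?_
    exact ⟨⟨EuclideanSpace.single 0 1, by simp⟩, by simpa using hc1⟩
  refine ⟨Real.arccos c, ⟨Real.arccos_pos.2 hc1, Real.arccos_le_pi_div_two.2 hc.1⟩, ?_⟩
  rw [hmom, hmom]
  have hrel := hsplit c
  have hne : m c 1 ≠ 0 := by
    intro h0
    rw [hGc, h0] at hrel
    linarith
  rw [eq_div_iff hne]
  linarith

theorem coneAngle_spec {N : ℕ} [NeZero N] (hN : 2 ≤ N) {p : ℝ} (hp : 2 ≤ p) :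
    IsConeAngle N p (coneAngle N p) :=
  Classical.epsilon_spec (exists_isConeAngle hN hp)

/-! ### Cones, the fractional measure and the operators -/

/-- The infinite cone with centerline along `y` and aperture angle `α_p`, truncated at radius `a`:
the points `z` with `∠(y, z) < α_p` and `|z| > a`. -/
def cone (N : ℕ) [NeZero N] (p a : ℝ) (y : Rn N) : Set (Rn N) :=
  {z | InnerProductGeometry.angle y z < coneAngle N p ∧ a < ‖z‖}

/-- The normalizing constant `C(N,s)` of the fractional Laplacian. -/
def fracConst (N : ℕ) (s : ℝ) : ℝ :=
  4 ^ s * s * Real.Gamma (N / 2 + s) / (Real.pi ^ ((N : ℝ) / 2) * Real.Gamma (1 - s))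

/-- The measure `C(N,s) |z|^{-N-2s} dz` on `ℝ^N`. -/
def fracMeasure (N : ℕ) (s : ℝ) : Measure (Rn N) :=
  (volume : Measure (Rn N)).withDensity
    fun z => ENNReal.ofReal (fracConst N s / ‖z‖ ^ ((N : ℝ) + 2 * s))

/-- The averaging operator: the mean of the supremum and of the infimum, over all directions
`|y| = 1`, of the averages of `z ↦ u (x + z)` over the cone in direction `y` truncated at `ε`. -/
def avgOp (N : ℕ) [NeZero N] (p s ε : ℝ) (u : Rn N → ℝ) (x : Rn N) : ℝ :=
  ((⨆ y : sphere (0 : Rn N) 1, ⨍ z in cone N p ε y, u (x + z) ∂(fracMeasure N s)) +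
    (⨅ y : sphere (0 : Rn N) 1, ⨍ z in cone N p ε y, u (x + z) ∂(fracMeasure N s))) / 2

/-- The operator `L_{s,p}`: the integral of `u (x + z) + u (x - z) - 2 u (x)` over the infinite
cone in direction `∇u(x) / |∇u(x)|`. It is meant for `u` with `∇u(x) ≠ 0`. -/
def fracOp (N : ℕ) [NeZero N] (p s : ℝ) (u : Rn N → ℝ) (x : Rn N) : ℝ :=
  ∫ z in cone N p 0 (‖gradient u x‖⁻¹ • gradient u x),
    (u (x + z) + u (x - z) - 2 * u x) ∂(fracMeasure N s)

/-- The geometric fractional `p`-Laplacian `Δ_p^s u(x)`, for `u` with `∇u(x) ≠ 0`. -/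
def fracPLaplacian (N : ℕ) [NeZero N] (p s : ℝ) (u : Rn N → ℝ) (x : Rn N) : ℝ :=
  (2 - 2 * s) / fracConst N s * ((N + p - 2) / (surf N).real (cup N (coneAngle N p))) *
    fracOp N p s u x

/-! ### The dynamic programming principle -/

/-- `u` is a (bounded, Borel) solution of the dynamic programming principle with radius `ε`
in `D`, with data `F` outside `D`. -/
structure IsDPPSolution (N : ℕ) [NeZero N] (p s : ℝ) (D : Set (Rn N)) (F : Rn N → ℝ) (ε : ℝ)
    (u : Rn N → ℝ) : Prop where
  measurable : Measurable u
  bounded : ∃ M : ℝ, ∀ x, |u x| ≤ M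
  eq_avg : ∀ x ∈ D, u x = avgOp N p s ε u x
  eq_data : ∀ x ∉ D, u x = F x

/-- Exterior cone condition: there is a finite cone (of opening `θ` and height `h`) such that at
every boundary point of `D` some rotated copy of it, with vertex at that point, does not
meet `D`. -/
def ExteriorCone (N : ℕ) (D : Set (Rn N)) : Prop :=
  ∃ θ h : ℝ, 0 < θ ∧ 0 < h ∧ ∀ x ∈ frontier D, ∃ e : Rn N, ‖e‖ = 1 ∧
    ∀ z : Rn N, InnerProductGeometry.angle e z < θ → 0 < ‖z‖ → ‖z‖ < h → x + z ∉ D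

/-! ### Viscosity solutions -/

/-- The function equal to `φ` on the closed ball of radius `r` about `x` and to `u` off it. -/
def glue {N : ℕ} (φ u : Rn N → ℝ) (x : Rn N) (r : ℝ) : Rn N → ℝ :=
  (closedBall x r).indicator φ + (closedBall x r)ᶜ.indicator u

/-- `u` is a viscosity solution of `Δ_p^s u = 0` in `D`, `u = F` outside `D`: it is bounded and
uniformly continuous, it equals `F` outside `D`, and it satisfies the comparison with `C²` test
functions of non-vanishing gradient that touch it at points of `D` from above (subsolution)
and from below (supersolution). -/
structure IsViscositySolution (N : ℕ) [NeZero N] (p s : ℝ) (D : Set (Rn N)) (F : Rn N → ℝ)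
    (u : Rn N → ℝ) : Prop where
  bounded : ∃ M : ℝ, ∀ x, |u x| ≤ M
  uniformContinuous : UniformContinuous u
  eq_data : ∀ x ∉ D, u x = F x
  sub : ∀ x ∈ D, ∀ r : ℝ, 0 < r → ∀ φ : Rn N → ℝ, ContDiff ℝ 2 φ → φ x = u x →
    gradient φ x ≠ 0 → (∀ z ∈ closedBall x r \ {x}, u z < φ z) →
    0 ≤ fracPLaplacian N p s (glue φ u x r) x
  super : ∀ x ∈ D, ∀ r : ℝ, 0 < r → ∀ φ : Rn N → ℝ, ContDiff ℝ 2 φ → φ x = u x →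
    gradient φ x ≠ 0 → (∀ z ∈ closedBall x r \ {x}, φ z < u z) →
    fracPLaplacian N p s (glue φ u x r) x ≤ 0

end

end GeomPLaplace

namespace GeomPLaplace

local notation "⟪" x ", " y "⟫" => inner ℝ x y

noncomputable section

/-! ### The fractional measure -/

/-! The proof is a compactness argument: comparison, a boundary barrier uniform in `ε`, translation
to the interior, Arzelà–Ascoli, and stability of viscosity inequalities.

Comparison (`le_of_le_avgOp`) is purely nonlocal. From a point of a bounded set, a fixed positive
fraction of the mass of every truncated cone lies at points outside the set, so the averages
strictly contract a positive supremum of the difference of a sub- and a supersolution. Constants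
then bound all solutions by the bound on `F`.

The barrier is `1 + κ log (1 + |v - a|² / δ²)`, centred outside `D`, on the axis of the exterior
cone, and set to zero on the part of the complement near the boundary point
(`exists_avgOp_le_of_hole`). At distance `R` from `a`, the first order terms along a direction and
along the inward radial one sum to at most zero, the remainder costs at most `8 κ H R^{-2s}`, and
the zero set, seen from the point as a ball of size proportional to `R` inside the inward cone,
gains `c R^{-2s}`. Both scale alike, so a small `κ` works for every `δ`. As the logarithm is
unbounded, a small `δ` makes the barrier exceed the data at a fixed distance while it stays small at
distance `δ`. This gives `exists_boundary_estimate`.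

Translates of solutions solve the translated problem, so comparison on `D ∩ (D - k)` turns the
boundary estimate into a modulus of continuity valid for all small `ε`
(`exists_asymptotic_modulus`), although each solution may be discontinuous. A subsequence converges
uniformly.

For the limit equation (`fracOp_glue_nonneg`), a test function touching the limit nearly touches `u
n` at points `ξ n → x`. Near `ξ n` the average in direction `y` has a gradient term of order
`ε^{1-2s}`, which blows up as `2s > 1`, against a bounded error; nearly maximizing directions
therefore converge to the direction of the gradient. Averages along such a direction and its
opposite add up to a second difference, which passes to the limit by dominated convergence, as `min
t t²` is integrable for `1 < 2s < 2`. -/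

theorem fracConst_pos {N : ℕ} {s : ℝ} (hs0 : 0 < s) (hs1 : s < 1) : 0 < fracConst N s := by
  unfold fracConst
  have h1 : 0 < Real.Gamma (N / 2 + s) := Real.Gamma_pos_of_pos (by positivity)
  have h2 : 0 < Real.Gamma (1 - s) := Real.Gamma_pos_of_pos (by linarith)
  have h3 : (0 : ℝ) < 4 ^ s := by positivity
  have h4 : 0 < Real.pi ^ ((N : ℝ) / 2) := Real.rpow_pos_of_pos Real.pi_pos _
  positivity

theorem measurable_fracDensity (N : ℕ) (s : ℝ) :
    Measurable fun z : Rn N => ENNReal.ofReal (fracConst N s / ‖z‖ ^ ((N : ℝ) + 2 * s)) :=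
  (measurable_const.div (measurable_norm.pow_const _)).ennreal_ofReal

theorem toReal_fracDensity {N : ℕ} {s : ℝ} (hs0 : 0 < s) (hs1 : s < 1) (z : Rn N) :
    (ENNReal.ofReal (fracConst N s / ‖z‖ ^ ((N : ℝ) + 2 * s))).toReal =
      fracConst N s / ‖z‖ ^ ((N : ℝ) + 2 * s) := by
  have := fracConst_pos (N := N) hs0 hs1
  exact ENNReal.toReal_ofReal (by positivity)

theorem integral_fracMeasure {N : ℕ} {s : ℝ} (hs0 : 0 < s) (hs1 : s < 1) (f : Rn N → ℝ) :
    ∫ z, f z ∂(fracMeasure N s) = ∫ z, fracConst N s / ‖z‖ ^ ((N : ℝ) + 2 * s) * f z := by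
  unfold fracMeasure
  rw [integral_withDensity_eq_integral_toReal_smul (measurable_fracDensity N s)
    (Eventually.of_forall fun _ => ENNReal.ofReal_lt_top)]
  simp only [toReal_fracDensity hs0 hs1, smul_eq_mul]

theorem integrable_fracMeasure_iff {N : ℕ} {s : ℝ} (hs0 : 0 < s) (hs1 : s < 1) (f : Rn N → ℝ) :
    Integrable f (fracMeasure N s) ↔
      Integrable fun z => fracConst N s / ‖z‖ ^ ((N : ℝ) + 2 * s) * f z := by
  unfold fracMeasure
  rw [integrable_withDensity_iff_integrable_smul' (measurable_fracDensity N s)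
    (Eventually.of_forall fun _ => ENNReal.ofReal_lt_top)]
  simp only [toReal_fracDensity hs0 hs1, smul_eq_mul]

/-- Scaling of the fractional measure. -/
theorem integral_comp_smul_fracMeasure {N : ℕ} {s : ℝ} (hs0 : 0 < s) (hs1 : s < 1)
    (f : Rn N → ℝ) {R : ℝ} (hR : 0 < R) :
    ∫ z, f (R • z) ∂(fracMeasure N s) = R ^ (2 * s) * ∫ z, f z ∂(fracMeasure N s) := by
  rw [integral_fracMeasure hs0 hs1, integral_fracMeasure hs0 hs1]
  set g : Rn N → ℝ := fun z => fracConst N s / ‖z‖ ^ ((N : ℝ) + 2 * s) * f z with hg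
  have h1 : ∀ z : Rn N, fracConst N s / ‖z‖ ^ ((N : ℝ) + 2 * s) * f (R • z) =
      R ^ ((N : ℝ) + 2 * s) * g (R • z) := by
    intro z
    simp only [hg]
    rw [norm_smul, Real.norm_of_nonneg hR.le, Real.mul_rpow hR.le (norm_nonneg _)]
    have : R ^ ((N : ℝ) + 2 * s) ≠ 0 := (Real.rpow_pos_of_pos hR _).ne'
    rw [← mul_assoc, ← mul_div_assoc, mul_div_mul_left _ _ this]
  simp only [h1]
  rw [integral_const_mul, Measure.integral_comp_smul_of_nonneg volume g R (hR := hR.le),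
    finrank_euclideanSpace_fin, smul_eq_mul, ← mul_assoc, Real.rpow_add hR, Real.rpow_natCast]
  have : R ^ N ≠ 0 := (pow_pos hR _).ne'
  congr 1
  field_simp

theorem measurePreserving_fracMeasure {N : ℕ} {s : ℝ} (f : Rn N ≃ₗᵢ[ℝ] Rn N) :
    MeasurePreserving f (fracMeasure N s) (fracMeasure N s) := by
  refine ⟨f.continuous.measurable, Measure.ext fun t ht => ?_⟩
  have hm := f.continuous.measurable
  rw [Measure.map_apply hm ht]
  unfold fracMeasure
  rw [withDensity_apply _ ht, withDensity_apply _ (hm ht)]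
  rw [← (f.measurePreserving).setLIntegral_comp_preimage ht (measurable_fracDensity N s)]
  simp

theorem integral_comp_isometry_fracMeasure {N : ℕ} {s : ℝ} (f : Rn N ≃ₗᵢ[ℝ] Rn N)
    (g : Rn N → ℝ) : ∫ z, g (f z) ∂(fracMeasure N s) = ∫ z, g z ∂(fracMeasure N s) :=
  MeasurePreserving.integral_comp' (f := f.toMeasurableEquiv) (measurePreserving_fracMeasure f) g

theorem ae_fracMeasure {N : ℕ} {s : ℝ} {P : Rn N → Prop} (h : ∀ᵐ z : Rn N, P z) :
    ∀ᵐ z ∂(fracMeasure N s), P z :=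
  (withDensity_absolutelyContinuous _ _).ae_le h

/-- The density is positive off the origin, and the origin is a Lebesgue null set. -/
theorem fracMeasure_pos_of_isOpen {N : ℕ} [NeZero N] {s : ℝ} (hs0 : 0 < s) (hs1 : s < 1)
    {U : Set (Rn N)} (hU : IsOpen U) (hne : U.Nonempty) : 0 < fracMeasure N s U := by
  rw [pos_iff_ne_zero]
  intro h
  unfold fracMeasure at h
  rw [withDensity_apply_eq_zero' (measurable_fracDensity N s).aemeasurable] at h
  have h2 : volume ({0}ᶜ ∩ U) = 0 := by
    refine measure_mono_null ?_ h
    rintro z ⟨hz, hzU⟩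
    refine ⟨?_, hzU⟩
    have : 0 < ‖z‖ := norm_pos_iff.2 hz
    have := fracConst_pos (N := N) hs0 hs1
    simp only [Set.mem_ofPred_eq, ne_eq, ENNReal.ofReal_eq_zero, not_le]
    positivity
  have h3 : volume U = 0 := by
    have : U ⊆ ({0}ᶜ ∩ U) ∪ {0} := fun z hz => by
      by_cases h : z = 0
      · exact Or.inr h
      · exact Or.inl ⟨h, hz⟩
    refine measure_mono_null this (measure_union_null h2 ?_)
    exact measure_singleton _
  exact (hU.measure_pos volume hne).ne' h3

/-! ### The dominating weight and its integrability -/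

/-- The weight `min t t²`, which is integrable for the fractional measure if `1 < 2 s < 2`. -/
def levyWeight (t : ℝ) : ℝ := min t (t ^ 2)

theorem continuous_levyWeight : Continuous levyWeight := by unfold levyWeight; fun_prop

theorem levyWeight_nonneg {t : ℝ} (ht : 0 ≤ t) : 0 ≤ levyWeight t :=
  le_min ht (sq_nonneg t)

theorem levyWeight_of_le_one {t : ℝ} (h0 : 0 ≤ t) (ht : t ≤ 1) : levyWeight t = t ^ 2 :=
  min_eq_right (by nlinarith)

theorem levyWeight_of_one_le {t : ℝ} (ht : 1 ≤ t) : levyWeight t = t :=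
  min_eq_left (by nlinarith)

/-- In polar coordinates the integrand is a multiple of `t^{1-2s}` near the origin, integrable since
`s < 1`, and of `t^{-2s}` at infinity, integrable since `s > 1/2`. -/
theorem integrable_levyWeight {N : ℕ} [NeZero N] {s : ℝ} (hs : s ∈ Set.Ioo (1 / 2 : ℝ) 1) :
    Integrable (fun z : Rn N => levyWeight ‖z‖) (fracMeasure N s) := by
  have hs0 : 0 < s := by linarith [hs.1]
  have hN1 : 1 ≤ N := Nat.one_le_iff_ne_zero.2 (NeZero.ne N)
  rw [integrable_fracMeasure_iff hs0 hs.2]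
  rw [integrable_fun_norm_addHaar (volume : Measure (Rn N))
    (f := fun t => fracConst N s / t ^ ((N : ℝ) + 2 * s) * levyWeight t)]
  rw [finrank_euclideanSpace_fin, ← Set.Ioc_union_Ioi_eq_Ioi zero_le_one, integrableOn_union]
  have key : ∀ t : ℝ, 0 < t → ∀ k : ℝ, levyWeight t = t ^ k →
      t ^ (N - 1) • (fracConst N s / t ^ ((N : ℝ) + 2 * s) * levyWeight t) =
        fracConst N s * t ^ (k - 1 - 2 * s) := by
    intro t ht k hk
    rw [hk, smul_eq_mul, ← Real.rpow_natCast, Nat.cast_sub hN1, Nat.cast_one,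
      div_eq_mul_inv, ← Real.rpow_neg ht.le, mul_assoc, ← Real.rpow_add ht, mul_left_comm,
      ← Real.rpow_add ht]
    congr 2
    ring
  constructor
  · have h1 : IntegrableOn (fun t : ℝ => fracConst N s * t ^ ((2 : ℝ) - 1 - 2 * s))
        (Set.Ioc 0 1) := by
      rw [integrableOn_Ioc_iff_integrableOn_Ioo]
      exact ((intervalIntegral.integrableOn_Ioo_rpow_iff one_pos).2
        (by linarith [hs.2])).const_mul _
    refine h1.congr_fun (fun t ht => ?_) measurableSet_Ioc
    exact (key t ht.1 2 (by
      rw [levyWeight_of_le_one ht.1.le ht.2]; exact (Real.rpow_two t).symm)).symm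
  · have h1 : IntegrableOn (fun t : ℝ => fracConst N s * t ^ ((1 : ℝ) - 1 - 2 * s))
        (Set.Ioi 1) :=
      (integrableOn_Ioi_rpow_of_lt (by linarith [hs.1]) one_pos).const_mul _
    refine h1.congr_fun (fun t ht => ?_) measurableSet_Ioi
    have ht' : (1 : ℝ) < t := ht
    exact (key t (by linarith) 1 (by rw [levyWeight_of_one_le ht'.le, Real.rpow_one])).symm

theorem integral_levyWeight_div {N : ℕ} {s : ℝ} (hs0 : 0 < s) (hs1 : s < 1) {R : ℝ} (hR : 0 < R) :
    ∫ z : Rn N, levyWeight (‖z‖ / R) ∂(fracMeasure N s) =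
      (R ^ (2 * s))⁻¹ * ∫ z : Rn N, levyWeight ‖z‖ ∂(fracMeasure N s) := by
  have h := integral_comp_smul_fracMeasure (N := N) hs0 hs1 (fun z => levyWeight (‖z‖ / R)) hR
  have h2 : R ^ (2 * s) ≠ 0 := (Real.rpow_pos_of_pos hR _).ne'
  rw [eq_inv_mul_iff_mul_eq₀ h2, ← h]
  refine integral_congr_ae (Eventually.of_forall fun z => ?_)
  simp only
  rw [norm_smul, Real.norm_of_nonneg hR.le, mul_div_cancel_left₀ _ hR.ne']

theorem integrable_levyWeight_div {N : ℕ} [NeZero N] {s : ℝ} (hs : s ∈ Set.Ioo (1 / 2 : ℝ) 1)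
    {R : ℝ} (hR : 0 < R) :
    Integrable (fun z : Rn N => levyWeight (‖z‖ / R)) (fracMeasure N s) := by
  -- `min (t/R) (t²/R²) ≤ (R⁻¹ + R⁻²) min t t²`, according to which term attains the minimum on the
  -- right.
  set B := R⁻¹ + (R⁻¹) ^ 2 with hB
  have hR' : 0 < R⁻¹ := inv_pos.2 hR
  refine ((integrable_levyWeight hs).const_mul B).mono'
    (continuous_levyWeight.comp (by fun_prop)).aestronglyMeasurable
    (Eventually.of_forall fun z => ?_)
  have h0 := norm_nonneg z
  rw [Real.norm_of_nonneg (levyWeight_nonneg (by positivity)), div_eq_mul_inv]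
  unfold levyWeight
  rcases min_cases ‖z‖ (‖z‖ ^ 2) with ⟨h, _⟩ | ⟨h, _⟩ <;> rw [h]
  · refine (min_le_left _ _).trans ?_
    nlinarith [mul_nonneg (sq_nonneg R⁻¹) h0]
  · refine (min_le_right _ _).trans ?_
    nlinarith [mul_nonneg hR'.le (sq_nonneg ‖z‖)]

end

noncomputable section

/-! ### Cones -/

theorem angle_lt_iff_of_norm_eq_one {N : ℕ} {y z : Rn N} (hy : ‖y‖ = 1) {θ : ℝ} (h0 : 0 < θ)
    (h1 : θ ≤ Real.pi / 2) :
    InnerProductGeometry.angle y z < θ ↔ Real.cos θ * ‖z‖ < ⟪y, z⟫ := by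
  have hpi := Real.pi_pos
  -- The angle with the zero vector is `π / 2` by convention, so for `z = 0` both sides fail because
  -- `θ ≤ π / 2`.
  rcases eq_or_ne z 0 with rfl | hz
  · simp [h1]
  have hz' : 0 < ‖z‖ := norm_pos_iff.2 hz
  rw [← (Real.strictAntiOn_cos).lt_iff_gt (a := θ) (b := InnerProductGeometry.angle y z)
    ⟨h0.le, by linarith⟩ ⟨InnerProductGeometry.angle_nonneg _ _, InnerProductGeometry.angle_le_pi _ _⟩,
    InnerProductGeometry.cos_angle, hy, one_mul, lt_div_iff₀ hz']

/-- The reflection in the hyperplane orthogonal to `y - y'`. -/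
theorem exists_isometry_map_eq {N : ℕ} {y y' : Rn N} (h : ‖y‖ = ‖y'‖) :
    ∃ f : Rn N ≃ₗᵢ[ℝ] Rn N, f y = y' := ⟨_, Submodule.reflection_sub h⟩

variable {N : ℕ} [NeZero N] {p s : ℝ}

/-- The cosine of the aperture angle. -/
def coneCos (N : ℕ) [NeZero N] (p : ℝ) : ℝ := Real.cos (coneAngle N p)

theorem coneCos_nonneg (hN : 2 ≤ N) (hp : 2 ≤ p) : 0 ≤ coneCos N p := by
  have h := (coneAngle_spec hN hp).1
  exact Real.cos_nonneg_of_mem_Icc ⟨by linarith [h.1, Real.pi_pos], h.2⟩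

theorem coneCos_lt_one (hN : 2 ≤ N) (hp : 2 ≤ p) : coneCos N p < 1 := by
  have h := (coneAngle_spec hN hp).1
  rw [← Real.cos_zero]
  exact Real.cos_lt_cos_of_nonneg_of_le_pi_div_two le_rfl h.2 h.1

theorem mem_cone_iff (hN : 2 ≤ N) (hp : 2 ≤ p) {a : ℝ} {y z : Rn N} (hy : ‖y‖ = 1) :
    z ∈ cone N p a y ↔ coneCos N p * ‖z‖ < ⟪y, z⟫ ∧ a < ‖z‖ := by
  have h := (coneAngle_spec hN hp).1
  simp only [cone, Set.mem_ofPred_eq, coneCos]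
  rw [angle_lt_iff_of_norm_eq_one hy h.1 h.2]

theorem isOpen_cone (hN : 2 ≤ N) (hp : 2 ≤ p) (a : ℝ) {y : Rn N} (hy : ‖y‖ = 1) :
    IsOpen (cone N p a y) := by
  have : cone N p a y = {z | coneCos N p * ‖z‖ < ⟪y, z⟫} ∩ {z | a < ‖z‖} := by
    ext z; exact mem_cone_iff hN hp hy
  rw [this]
  exact (isOpen_lt (by fun_prop) (by fun_prop)).inter (isOpen_lt (by fun_prop) (by fun_prop))

theorem measurableSet_cone (hN : 2 ≤ N) (hp : 2 ≤ p) (a : ℝ) {y : Rn N} (hy : ‖y‖ = 1) :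
    MeasurableSet (cone N p a y) := (isOpen_cone hN hp a hy).measurableSet

theorem cone_nonempty (hN : 2 ≤ N) (hp : 2 ≤ p) {a : ℝ} (ha : 0 ≤ a) {y : Rn N} (hy : ‖y‖ = 1) :
    (cone N p a y).Nonempty := by
  refine ⟨(a + 1) • y, (mem_cone_iff hN hp hy).2 ?_⟩
  rw [norm_smul, Real.norm_of_nonneg (by linarith), hy, real_inner_smul_right,
    real_inner_self_eq_norm_sq, hy]
  have := coneCos_lt_one hN hp
  constructor <;> nlinarith

/-! ### Behaviour of cones under isometries and dilations -/

theorem map_mem_cone_iff (f : Rn N ≃ₗᵢ[ℝ] Rn N) {a : ℝ} {y z : Rn N} :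
    f z ∈ cone N p a (f y) ↔ z ∈ cone N p a y := by
  simp only [cone, Set.mem_ofPred_eq, f.norm_map]
  have := f.toLinearIsometry.angle_map y z
  simp only [LinearIsometryEquiv.coe_toLinearIsometry] at this
  rw [this]

theorem smul_mem_cone_iff {R : ℝ} (hR : 0 < R) {a : ℝ} {y z : Rn N} :
    R • z ∈ cone N p (R * a) y ↔ z ∈ cone N p a y := by
  simp only [cone, Set.mem_ofPred_eq, norm_smul, Real.norm_of_nonneg hR.le,
    InnerProductGeometry.angle_smul_right_of_pos _ _ hR, mul_lt_mul_iff_right₀ hR]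

theorem setIntegral_cone_isometry (hN : 2 ≤ N) (hp : 2 ≤ p) (f : Rn N ≃ₗᵢ[ℝ] Rn N) (a : ℝ)
    {y : Rn N} (hy : ‖y‖ = 1) (g : Rn N → ℝ) :
    ∫ z in cone N p a (f y), g z ∂(fracMeasure N s) =
      ∫ z in cone N p a y, g (f z) ∂(fracMeasure N s) := by
  rw [← integral_indicator (measurableSet_cone hN hp a (by rwa [f.norm_map])),
    ← integral_indicator (measurableSet_cone hN hp a hy),
    ← integral_comp_isometry_fracMeasure f]
  refine integral_congr_ae (Eventually.of_forall fun z => ?_)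
  by_cases h : z ∈ cone N p a y <;> simp [h, map_mem_cone_iff]

theorem setIntegral_cone_smul (hN : 2 ≤ N) (hp : 2 ≤ p) (hs0 : 0 < s) (hs1 : s < 1)
    {ε : ℝ} (hε : 0 < ε) {y : Rn N} (hy : ‖y‖ = 1) (g : Rn N → ℝ) :
    ∫ z in cone N p 1 y, g (ε • z) ∂(fracMeasure N s) =
      ε ^ (2 * s) * ∫ z in cone N p ε y, g z ∂(fracMeasure N s) := by
  rw [← integral_indicator (measurableSet_cone hN hp _ hy),
    ← integral_indicator (measurableSet_cone hN hp _ hy),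
    ← integral_comp_smul_fracMeasure hs0 hs1 _ hε]
  refine integral_congr_ae (Eventually.of_forall fun z => ?_)
  have := smul_mem_cone_iff (N := N) (p := p) hε (a := 1) (y := y) (z := z)
  rw [mul_one] at this
  by_cases h : z ∈ cone N p 1 y <;> simp [h, this]

/-! ### Masses and first moments of truncated cones -/

/-- The mass of the cone truncated at radius `1`. -/
def coneMass (N : ℕ) [NeZero N] (p s : ℝ) : ℝ :=
  (fracMeasure N s).real (cone N p 1 (EuclideanSpace.single 0 1))

/-- The axial first moment of the cone truncated at radius `1`. -/
def coneMean (N : ℕ) [NeZero N] (p s : ℝ) : ℝ :=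
  ∫ z in cone N p 1 (EuclideanSpace.single 0 1), ⟪EuclideanSpace.single 0 1, z⟫ ∂(fracMeasure N s)

/-- Where `‖z‖ > a`, the norm is `a` times the weight at `‖z‖ / a`. -/
theorem integrableOn_norm_compl_ball (hs : s ∈ Set.Ioo (1 / 2 : ℝ) 1) {a : ℝ} (ha : 0 < a)
    {t : Set (Rn N)} (htm : MeasurableSet t) (ht : ∀ z ∈ t, a < ‖z‖) :
    IntegrableOn (fun z : Rn N => ‖z‖) t (fracMeasure N s) := by
  refine Integrable.mono' (((integrable_levyWeight_div (N := N) hs ha).const_mul a).integrableOn)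
    continuous_norm.aestronglyMeasurable ?_
  refine (ae_restrict_iff' htm).2 (Eventually.of_forall fun z hz => ?_)
  have := ht z hz
  rw [levyWeight_of_one_le (by rw [le_div_iff₀ ha]; linarith), norm_norm]
  field_simp
  exact le_rfl

theorem fracMeasure_lt_top (hs : s ∈ Set.Ioo (1 / 2 : ℝ) 1) {a : ℝ} (ha : 0 < a)
    {t : Set (Rn N)} (htm : MeasurableSet t) (ht : ∀ z ∈ t, a < ‖z‖) :
    fracMeasure N s t < ⊤ := by
  have h : IntegrableOn (fun _ : Rn N => (1 : ℝ)) t (fracMeasure N s) := by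
    refine Integrable.mono' ((integrableOn_norm_compl_ball hs ha htm ht).const_mul a⁻¹)
      aestronglyMeasurable_const ?_
    refine (ae_restrict_iff' htm).2 (Eventually.of_forall fun z hz => ?_)
    have := ht z hz
    rw [norm_one, inv_mul_eq_div, le_div_iff₀ ha]
    linarith
  simpa [integrableOn_const_iff] using h

theorem fracMeasure_cone_lt_top (hN : 2 ≤ N) (hp : 2 ≤ p) (hs : s ∈ Set.Ioo (1 / 2 : ℝ) 1)
    {a : ℝ} (ha : 0 < a) {y : Rn N} (hy : ‖y‖ = 1) :
    fracMeasure N s (cone N p a y) < ⊤ :=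
  fracMeasure_lt_top hs ha (measurableSet_cone hN hp a hy) fun _ hz => hz.2

theorem integrableOn_inner_cone (hN : 2 ≤ N) (hp : 2 ≤ p) (hs : s ∈ Set.Ioo (1 / 2 : ℝ) 1)
    {a : ℝ} (ha : 0 < a) {y : Rn N} (hy : ‖y‖ = 1) (X : Rn N) :
    IntegrableOn (fun z : Rn N => ⟪X, z⟫) (cone N p a y) (fracMeasure N s) := by
  refine Integrable.mono' ((integrableOn_norm_compl_ball hs ha (measurableSet_cone hN hp a hy)
    fun _ hz => hz.2).const_mul ‖X‖) (by fun_prop) (Eventually.of_forall fun z => ?_)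
  exact norm_inner_le_norm X z

theorem integrableOn_cone_of_bounded (hN : 2 ≤ N) (hp : 2 ≤ p) (hs : s ∈ Set.Ioo (1 / 2 : ℝ) 1)
    {a : ℝ} (ha : 0 < a) {y : Rn N} (hy : ‖y‖ = 1) {g : Rn N → ℝ} (hg : Measurable g) {M : ℝ}
    (hM : ∀ z, |g z| ≤ M) : IntegrableOn g (cone N p a y) (fracMeasure N s) := by
  refine Measure.integrableOn_of_bounded (M := M) (fracMeasure_cone_lt_top hN hp hs ha hy).ne
    hg.aestronglyMeasurable (Eventually.of_forall hM)

theorem norm_single_one : ‖(EuclideanSpace.single 0 1 : Rn N)‖ = 1 := by simp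

/-- Rotate to `e₁` and dilate to radius `1`. Independence of `y` allows averages in opposite
directions to be added with a common weight. -/
theorem real_cone (hN : 2 ≤ N) (hp : 2 ≤ p) (hs : s ∈ Set.Ioo (1 / 2 : ℝ) 1)
    {a : ℝ} (ha : 0 < a) {y : Rn N} (hy : ‖y‖ = 1) :
    (fracMeasure N s).real (cone N p a y) = (a ^ (2 * s))⁻¹ * coneMass N p s := by
  have hs0 : 0 < s := by linarith [hs.1]
  have h2 : a ^ (2 * s) ≠ 0 := (Real.rpow_pos_of_pos ha _).ne'
  obtain ⟨f, hf⟩ := exists_isometry_map_eq ((norm_single_one (N := N)).trans hy.symm)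
  have h3 := setIntegral_cone_smul hN hp hs0 hs.2 ha hy (fun _ => (1 : ℝ))
  have h4 := setIntegral_cone_isometry (s := s) hN hp f 1 (norm_single_one (N := N))
    (fun _ => (1 : ℝ))
  rw [hf] at h4
  rw [h4] at h3
  simp only [integral_const, smul_eq_mul, mul_one, measureReal_restrict_apply_univ] at h3
  rw [eq_inv_mul_iff_mul_eq₀ h2, ← h3]
  rfl

/-- The first moment vector of the cone is parallel to its axis by symmetry, and dilation gives its
size `a^{1-2s}`. -/
theorem integral_inner_cone (hN : 2 ≤ N) (hp : 2 ≤ p) (hs : s ∈ Set.Ioo (1 / 2 : ℝ) 1)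
    {a : ℝ} (ha : 0 < a) {y : Rn N} (hy : ‖y‖ = 1) (X : Rn N) :
    ∫ z in cone N p a y, ⟪X, z⟫ ∂(fracMeasure N s) =
      a / a ^ (2 * s) * coneMean N p s * ⟪X, y⟫ := by
  have hs0 : 0 < s := by linarith [hs.1]
  have h2 : a ^ (2 * s) ≠ 0 := (Real.rpow_pos_of_pos ha _).ne'
  obtain ⟨f, hf⟩ := exists_isometry_map_eq ((norm_single_one (N := N)).trans hy.symm)
  have hax : ∫ z in cone N p a y, ⟪y, z⟫ ∂(fracMeasure N s) = a / a ^ (2 * s) * coneMean N p s := by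
    have h3 := setIntegral_cone_smul hN hp hs0 hs.2 ha hy (fun z => ⟪y, z⟫)
    have h4 := setIntegral_cone_isometry (s := s) hN hp f 1 (norm_single_one (N := N))
      (fun z => ⟪y, a • z⟫)
    rw [hf] at h4
    rw [h4] at h3
    simp only [real_inner_smul_right, integral_const_mul] at h3
    rw [← hf] at h3
    simp only [f.inner_map_map] at h3
    rw [hf] at h3
    rw [div_mul_eq_mul_div, eq_div_iff h2, mul_comm, ← h3]
    rfl
  -- The component of `X` orthogonal to the axis contributes nothing: the reflection across the line
  -- of `y` preserves the cone and negates `X'`.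
  set X' := X - ⟪X, y⟫ • y with hX'
  have horth : ⟪y, X'⟫ = 0 := by
    rw [hX', inner_sub_right, real_inner_smul_right, real_inner_self_eq_norm_sq, hy,
      real_inner_comm]
    ring
  have h0 : ∫ z in cone N p a y, ⟪X', z⟫ ∂(fracMeasure N s) = 0 := by
    set r := (Submodule.span ℝ {y}).reflection with hr
    have hry : r y = y :=
      Submodule.reflection_mem_subspace_eq_self (Submodule.mem_span_singleton_self y)
    have hrX : r X' = -X' := by
      refine Submodule.reflection_mem_subspace_orthogonalComplement_eq_neg ?_
      rw [Submodule.mem_orthogonal_singleton_iff_inner_right]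
      exact horth
    have h5 := setIntegral_cone_isometry (s := s) hN hp r a hy (fun z => ⟪X', z⟫)
    rw [hry] at h5
    have h6 : ∀ z, ⟪X', r z⟫ = -⟪X', z⟫ := by
      intro z
      have : X' = -r X' := by rw [hrX, neg_neg]
      nth_rewrite 1 [this]
      rw [inner_neg_left, r.inner_map_map]
    simp only [h6, integral_neg] at h5
    linarith
  have hsplit : ∀ z, ⟪X, z⟫ = ⟪X, y⟫ * ⟪y, z⟫ + ⟪X', z⟫ := by
    intro z
    rw [hX', inner_sub_left, real_inner_smul_left]
    ring
  rw [show (fun z => ⟪X, z⟫) = fun z => ⟪X, y⟫ * ⟪y, z⟫ + ⟪X', z⟫ from funext hsplit,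
    integral_add ((integrableOn_inner_cone hN hp hs ha hy y).const_mul _)
    (integrableOn_inner_cone hN hp hs ha hy X'), integral_const_mul, h0, hax]
  ring

theorem coneMass_pos (hN : 2 ≤ N) (hp : 2 ≤ p) (hs : s ∈ Set.Ioo (1 / 2 : ℝ) 1) :
    0 < coneMass N p s := by
  have hs0 : 0 < s := by linarith [hs.1]
  exact ENNReal.toReal_pos (fracMeasure_pos_of_isOpen hs0 hs.2
    (isOpen_cone hN hp 1 norm_single_one) (cone_nonempty hN hp zero_le_one norm_single_one)).ne'
    (fracMeasure_cone_lt_top hN hp hs one_pos norm_single_one).ne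

/-- The aperture is at most `π / 2`, so the axial component is positive throughout the cone. -/
theorem coneMean_pos (hN : 2 ≤ N) (hp : 2 ≤ p) (hs : s ∈ Set.Ioo (1 / 2 : ℝ) 1) :
    0 < coneMean N p s := by
  have hs0 : 0 < s := by linarith [hs.1]
  have hy := norm_single_one (N := N)
  have hm := measurableSet_cone hN hp 1 hy
  have hpos : ∀ z ∈ cone N p 1 (EuclideanSpace.single (0 : Fin N) (1 : ℝ)),
      0 < ⟪(EuclideanSpace.single (0 : Fin N) (1 : ℝ) : Rn N), z⟫ := fun z hz => by
    have h := (mem_cone_iff hN hp hy).1 hz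
    exact lt_of_le_of_lt (mul_nonneg (coneCos_nonneg hN hp) (norm_nonneg z)) h.1
  unfold coneMean
  rw [setIntegral_pos_iff_support_of_nonneg_ae]
  · refine (fracMeasure_pos_of_isOpen hs0 hs.2 (isOpen_cone hN hp 1 hy)
      (cone_nonempty hN hp zero_le_one hy)).trans_le (measure_mono fun z hz => ⟨?_, hz⟩)
    exact (hpos z hz).ne'
  · exact (ae_restrict_iff' hm).2 (Eventually.of_forall fun z hz => (hpos z hz).le)
  · exact integrableOn_inner_cone hN hp hs one_pos hy _

end

noncomputable section

variable {N : ℕ} [NeZero N] {p s : ℝ}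

/-! ### The averaging operator -/

/-- The average of `z ↦ u (x + z)` over the cone in direction `y` truncated at `ε`. -/
def coneAvg (N : ℕ) [NeZero N] (p s ε : ℝ) (u : Rn N → ℝ) (x y : Rn N) : ℝ :=
  ⨍ z in cone N p ε y, u (x + z) ∂(fracMeasure N s)

theorem avgOp_eq (ε : ℝ) (u : Rn N → ℝ) (x : Rn N) :
    avgOp N p s ε u x = ((⨆ y : sphere (0 : Rn N) 1, coneAvg N p s ε u x y) +
      (⨅ y : sphere (0 : Rn N) 1, coneAvg N p s ε u x y)) / 2 := rfl

instance : Nonempty (sphere (0 : Rn N) 1) := ⟨⟨EuclideanSpace.single 0 1, by simp⟩⟩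

theorem norm_coe_sphere {N : ℕ} (y : sphere (0 : Rn N) 1) : ‖(y : Rn N)‖ = 1 := by simp

theorem coneAvg_eq (ε : ℝ) (u : Rn N → ℝ) (x y : Rn N) :
    coneAvg N p s ε u x y = ((fracMeasure N s).real (cone N p ε y))⁻¹ *
      ∫ z in cone N p ε y, u (x + z) ∂(fracMeasure N s) := by
  rw [coneAvg, setAverage_eq, smul_eq_mul]

theorem real_cone_pos (hN : 2 ≤ N) (hp : 2 ≤ p) (hs : s ∈ Set.Ioo (1 / 2 : ℝ) 1)
    {a : ℝ} (ha : 0 < a) {y : Rn N} (hy : ‖y‖ = 1) :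
    0 < (fracMeasure N s).real (cone N p a y) := by
  rw [real_cone hN hp hs ha hy]
  have := coneMass_pos hN hp hs
  have := Real.rpow_pos_of_pos ha (2 * s)
  positivity

theorem integrableOn_cone_comp_add (hN : 2 ≤ N) (hp : 2 ≤ p) (hs : s ∈ Set.Ioo (1 / 2 : ℝ) 1)
    {a : ℝ} (ha : 0 < a) {y : Rn N} (hy : ‖y‖ = 1) {u : Rn N → ℝ} (hu : Measurable u) {M : ℝ}
    (hM : ∀ z, |u z| ≤ M) (x : Rn N) :
    IntegrableOn (fun z => u (x + z)) (cone N p a y) (fracMeasure N s) :=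
  integrableOn_cone_of_bounded hN hp hs ha hy (hu.comp (measurable_const_add x)) fun _ => hM _

/-- The deviation of the average from a constant, as an integral over the cone. -/
theorem coneAvg_sub_const (hN : 2 ≤ N) (hp : 2 ≤ p) (hs : s ∈ Set.Ioo (1 / 2 : ℝ) 1)
    {ε : ℝ} (hε : 0 < ε) {y : Rn N} (hy : ‖y‖ = 1) {u : Rn N → ℝ} (hu : Measurable u) {M : ℝ}
    (hM : ∀ z, |u z| ≤ M) (x : Rn N) (c : ℝ) :
    (fracMeasure N s).real (cone N p ε y) * (coneAvg N p s ε u x y - c) =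
      ∫ z in cone N p ε y, (u (x + z) - c) ∂(fracMeasure N s) := by
  have hm := real_cone_pos hN hp hs hε hy
  have hf := fracMeasure_cone_lt_top (s := s) hN hp hs hε hy
  have : IsFiniteMeasure ((fracMeasure N s).restrict (cone N p ε y)) := ⟨by simpa using hf⟩
  rw [integral_sub (integrableOn_cone_comp_add hN hp hs hε hy hu hM x) (integrable_const c),
    coneAvg_eq, integral_const, measureReal_restrict_apply_univ, smul_eq_mul]
  field_simp

theorem coneAvg_mono_add (hN : 2 ≤ N) (hp : 2 ≤ p) (hs : s ∈ Set.Ioo (1 / 2 : ℝ) 1)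
    {ε : ℝ} (hε : 0 < ε) {y : Rn N} (hy : ‖y‖ = 1) {u w : Rn N → ℝ} (hu : Measurable u)
    (hw : Measurable w) {M M' : ℝ} (hM : ∀ z, |u z| ≤ M) (hM' : ∀ z, |w z| ≤ M') {K : ℝ}
    (h : ∀ z, u z ≤ w z + K) (x : Rn N) :
    coneAvg N p s ε u x y ≤ coneAvg N p s ε w x y + K := by
  have hm := real_cone_pos hN hp hs hε hy
  have hf := fracMeasure_cone_lt_top (s := s) hN hp hs hε hy
  have : IsFiniteMeasure ((fracMeasure N s).restrict (cone N p ε y)) := ⟨by simpa using hf⟩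
  have h1 := coneAvg_sub_const hN hp hs hε hy hu hM x K
  have h2 := coneAvg_sub_const hN hp hs hε hy hw hM' x 0
  have h3 : ∫ z in cone N p ε y, (u (x + z) - K) ∂(fracMeasure N s) ≤
      ∫ z in cone N p ε y, (w (x + z) - 0) ∂(fracMeasure N s) := by
    refine integral_mono
      ((integrableOn_cone_comp_add hN hp hs hε hy hu hM x).sub (integrable_const K))
      ((integrableOn_cone_comp_add hN hp hs hε hy hw hM' x).sub (integrable_const 0))
      fun z => ?_
    have := h (x + z)
    simp only
    linarith
  rw [← h1, ← h2] at h3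
  have := le_of_mul_le_mul_left h3 hm
  linarith

theorem coneAvg_neg (ε : ℝ) (u : Rn N → ℝ) (x y : Rn N) :
    coneAvg N p s ε (fun z => -u z) x y = -coneAvg N p s ε u x y := by
  simp only [coneAvg_eq, integral_neg, mul_neg]

theorem abs_coneAvg_le (hN : 2 ≤ N) (hp : 2 ≤ p) (hs : s ∈ Set.Ioo (1 / 2 : ℝ) 1)
    {ε : ℝ} (hε : 0 < ε) {y : Rn N} (hy : ‖y‖ = 1) {u : Rn N → ℝ} {M : ℝ}
    (hM : ∀ z, |u z| ≤ M) (x : Rn N) : |coneAvg N p s ε u x y| ≤ M := by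
  have hm := real_cone_pos hN hp hs hε hy
  have hf := fracMeasure_cone_lt_top (s := s) hN hp hs hε hy
  rw [coneAvg_eq, abs_mul, abs_inv, abs_of_pos hm, inv_mul_le_iff₀ hm, mul_comm]
  exact norm_setIntegral_le_of_norm_le_const (f := fun z => u (x + z)) hf fun z _ => hM _

theorem bddAbove_coneAvg (hN : 2 ≤ N) (hp : 2 ≤ p) (hs : s ∈ Set.Ioo (1 / 2 : ℝ) 1)
    {ε : ℝ} (hε : 0 < ε) {u : Rn N → ℝ} {M : ℝ} (hM : ∀ z, |u z| ≤ M) (x : Rn N) :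
    BddAbove (Set.range fun y : sphere (0 : Rn N) 1 => coneAvg N p s ε u x y) := by
  refine ⟨M, ?_⟩
  rintro _ ⟨y, rfl⟩
  exact (abs_le.1 (abs_coneAvg_le hN hp hs hε (norm_coe_sphere y) hM x)).2

theorem bddBelow_coneAvg (hN : 2 ≤ N) (hp : 2 ≤ p) (hs : s ∈ Set.Ioo (1 / 2 : ℝ) 1)
    {ε : ℝ} (hε : 0 < ε) {u : Rn N → ℝ} {M : ℝ} (hM : ∀ z, |u z| ≤ M) (x : Rn N) :
    BddBelow (Set.range fun y : sphere (0 : Rn N) 1 => coneAvg N p s ε u x y) := by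
  refine ⟨-M, ?_⟩
  rintro _ ⟨y, rfl⟩
  exact (abs_le.1 (abs_coneAvg_le hN hp hs hε (norm_coe_sphere y) hM x)).1

/-- The directional bound is required only at the point `x`; it passes through both the supremum and
the infimum. -/
theorem avgOp_le_add (hN : 2 ≤ N) (hp : 2 ≤ p) (hs : s ∈ Set.Ioo (1 / 2 : ℝ) 1)
    {ε : ℝ} (hε : 0 < ε) {u w : Rn N → ℝ} {M M' : ℝ} (hM : ∀ z, |u z| ≤ M)
    (hM' : ∀ z, |w z| ≤ M') {K : ℝ} {x : Rn N}
    (h : ∀ y : Rn N, ‖y‖ = 1 → coneAvg N p s ε u x y ≤ coneAvg N p s ε w x y + K) :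
    avgOp N p s ε u x ≤ avgOp N p s ε w x + K := by
  have h1 : (⨆ y : sphere (0 : Rn N) 1, coneAvg N p s ε u x y) ≤
      (⨆ y : sphere (0 : Rn N) 1, coneAvg N p s ε w x y) + K :=
    ciSup_le fun y => (h y (norm_coe_sphere y)).trans
      (by gcongr; exact le_ciSup (bddAbove_coneAvg hN hp hs hε hM' x) y)
  have h2 : (⨅ y : sphere (0 : Rn N) 1, coneAvg N p s ε u x y) - K ≤
      (⨅ y : sphere (0 : Rn N) 1, coneAvg N p s ε w x y) :=
    le_ciInf fun y => by
      have := ciInf_le (bddBelow_coneAvg hN hp hs hε hM x) y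
      have := h y (norm_coe_sphere y)
      linarith
  rw [avgOp_eq, avgOp_eq]
  linarith

theorem avgOp_mono_add (hN : 2 ≤ N) (hp : 2 ≤ p) (hs : s ∈ Set.Ioo (1 / 2 : ℝ) 1)
    {ε : ℝ} (hε : 0 < ε) {u w : Rn N → ℝ} (hu : Measurable u)
    (hw : Measurable w) {M M' : ℝ} (hM : ∀ z, |u z| ≤ M) (hM' : ∀ z, |w z| ≤ M') {K : ℝ}
    (h : ∀ z, u z ≤ w z + K) (x : Rn N) :
    avgOp N p s ε u x ≤ avgOp N p s ε w x + K :=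
  avgOp_le_add hN hp hs hε hM hM' fun _ hy =>
    coneAvg_mono_add hN hp hs hε hy hu hw hM hM' h x

/-- Negation exchanges the supremum and the infimum. Through this symmetry one-sided estimates yield
two-sided ones. -/
theorem avgOp_neg (ε : ℝ) (u : Rn N → ℝ) (x : Rn N) :
    avgOp N p s ε (fun z => -u z) x = -avgOp N p s ε u x := by
  simp only [avgOp_eq, coneAvg_neg]
  set g : sphere (0 : Rn N) 1 → ℝ := fun y => coneAvg N p s ε u x y
  have h : Set.range (fun y => -g y) = -Set.range g := by
    rw [← Set.image_neg_eq_neg, ← Set.range_comp]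
    rfl
  change (sSup (Set.range fun y => -g y) + sInf (Set.range fun y => -g y)) / 2 =
    -((sSup (Set.range g) + sInf (Set.range g)) / 2)
  rw [h, Real.sSup_neg, Real.sInf_neg]
  ring

theorem avgOp_comp_add (ε : ℝ) (u : Rn N → ℝ) (h x : Rn N) :
    avgOp N p s ε (fun z => u (z + h)) x = avgOp N p s ε u (x + h) := by
  have : ∀ z, x + z + h = x + h + z := fun z => by abel
  simp only [avgOp_eq, coneAvg, this]

/-- An upper bound for the averaging operator by the use of one direction for the infimum. -/
theorem avgOp_le_of_forall (hN : 2 ≤ N) (hp : 2 ≤ p) (hs : s ∈ Set.Ioo (1 / 2 : ℝ) 1)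
    {ε : ℝ} (hε : 0 < ε) {u : Rn N → ℝ} {M : ℝ} (hM : ∀ z, |u z| ≤ M) {x y₀ : Rn N}
    (hy₀ : ‖y₀‖ = 1) {c : ℝ}
    (h : ∀ y : Rn N, ‖y‖ = 1 → coneAvg N p s ε u x y + coneAvg N p s ε u x y₀ ≤ 2 * c) :
    avgOp N p s ε u x ≤ c := by
  have h1 : (⨆ y : sphere (0 : Rn N) 1, coneAvg N p s ε u x y) ≤
      2 * c - coneAvg N p s ε u x y₀ :=
    ciSup_le fun y => by linarith [h y (norm_coe_sphere y)]
  have h2 := ciInf_le (bddBelow_coneAvg (p := p) hN hp hs hε hM x)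
    (⟨y₀, by simpa using hy₀⟩ : sphere (0 : Rn N) 1)
  rw [avgOp_eq]
  linarith

/-- A nearly optimal direction for the supremum. -/
theorem exists_avgOp_le (hN : 2 ≤ N) (hp : 2 ≤ p) (hs : s ∈ Set.Ioo (1 / 2 : ℝ) 1)
    {ε : ℝ} (hε : 0 < ε) {u : Rn N → ℝ} {M : ℝ} (hM : ∀ z, |u z| ≤ M) (x : Rn N) {t : ℝ}
    (ht : 0 < t) : ∃ y : Rn N, ‖y‖ = 1 ∧ ∀ y' : Rn N, ‖y'‖ = 1 →
      coneAvg N p s ε u x y' ≤ coneAvg N p s ε u x y + t ∧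
      2 * avgOp N p s ε u x ≤ coneAvg N p s ε u x y + coneAvg N p s ε u x y' + t := by
  obtain ⟨y, hy⟩ := exists_lt_of_lt_ciSup (f := fun y : sphere (0 : Rn N) 1 =>
    coneAvg N p s ε u x y) (sub_lt_self _ ht)
  refine ⟨y, norm_coe_sphere y, fun y' hy' => ?_⟩
  have h1 := le_ciSup (bddAbove_coneAvg (p := p) hN hp hs hε hM x)
    (⟨y', by simpa using hy'⟩ : sphere (0 : Rn N) 1)
  have h2 := ciInf_le (bddBelow_coneAvg (p := p) hN hp hs hε hM x)
    (⟨y', by simpa using hy'⟩ : sphere (0 : Rn N) 1)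
  rw [avgOp_eq]
  simp only at h1 h2
  constructor <;> linarith

/-! ### Comparison -/

/-- Comparison principle for the dynamic programming principle in a bounded set. -/
theorem le_of_le_avgOp (hN : 2 ≤ N) (hp : 2 ≤ p) (hs : s ∈ Set.Ioo (1 / 2 : ℝ) 1)
    {ε : ℝ} (hε : 0 < ε) {E : Set (Rn N)} (hE : Bornology.IsBounded E) {u w : Rn N → ℝ}
    (hu : Measurable u) (hw : Measurable w) {M M' : ℝ} (hM : ∀ z, |u z| ≤ M)
    (hM' : ∀ z, |w z| ≤ M') (hsub : ∀ x ∈ E, u x ≤ avgOp N p s ε u x)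
    (hsup : ∀ x ∈ E, avgOp N p s ε w x ≤ w x) (hout : ∀ x ∉ E, u x ≤ w x) (x : Rn N) :
    u x ≤ w x := by
  set d : Rn N → ℝ := fun z => u z - w z with hd
  have hdm : Measurable d := hu.sub hw
  have hdb : ∀ z, |d z| ≤ M + M' := fun z => (abs_sub _ _).trans (add_le_add (hM z) (hM' z))
  have hbdd : BddAbove (Set.range d) := ⟨M + M', by rintro _ ⟨z, rfl⟩; exact (abs_le.1 (hdb z)).2⟩
  set S := ⨆ z, d z with hS
  by_contra hcon
  have hSpos : 0 < S := lt_of_lt_of_le (sub_pos.2 (not_le.1 hcon)) (le_ciSup hbdd x)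
  obtain ⟨R₀, hR₀⟩ := hE.subset_closedBall (0 : Rn N)
  -- No jump longer than `2 R₀` joins two points of `E`; the maximum with `ε` keeps the cone
  -- truncated at `R` inside the one truncated at `ε`.
  set R := max (2 * R₀) ε with hR
  have hRpos : 0 < R := lt_max_of_lt_right hε
  -- The proportion of the cone's mass that lies beyond radius `R`.
  set q := (ε ^ (2 * s)) / R ^ (2 * s) with hq
  have hqpos : 0 < q := div_pos (Real.rpow_pos_of_pos hε _) (Real.rpow_pos_of_pos hRpos _)
  have hjump : ∀ z ∈ E, ∀ z', z + z' ∈ E → ‖z'‖ ≤ R := by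
    intro z hz z' hz'
    have h1 := mem_closedBall_zero_iff.1 (hR₀ hz)
    have h2 := mem_closedBall_zero_iff.1 (hR₀ hz')
    have h3 : z' = (z + z') - z := by abel
    have h4 := norm_sub_le (z + z') z
    rw [← h3] at h4
    exact (by linarith : ‖z'‖ ≤ 2 * R₀).trans (le_max_left _ _)
  -- Jumps beyond `R` land outside `E`, where the difference is nonpositive; all other jumps see at
  -- most `S`.
  have hstep : ∀ z ∈ E, d z ≤ (1 - q) * S := by
    intro z hz
    have key : avgOp N p s ε u z ≤ avgOp N p s ε w z + (1 - q) * S := by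
      refine avgOp_le_add hN hp hs hε hM hM' fun y hy => ?_
      have hm := real_cone_pos (p := p) hN hp hs hε hy
      have hmR : (fracMeasure N s).real (cone N p R y) =
          q * (fracMeasure N s).real (cone N p ε y) := by
        rw [real_cone hN hp hs hε hy, real_cone hN hp hs hRpos hy, hq]
        have := (Real.rpow_pos_of_pos hε (2 * s)).ne'
        field_simp
      have hcm := measurableSet_cone (p := p) hN hp R hy
      have hfR := fracMeasure_cone_lt_top (s := s) (p := p) hN hp hs hRpos hy
      have hf := fracMeasure_cone_lt_top (s := s) (p := p) hN hp hs hε hy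
      have : IsFiniteMeasure ((fracMeasure N s).restrict (cone N p ε y)) := ⟨by simpa using hf⟩
      have hsubset : cone N p R y ⊆ cone N p ε y :=
        fun v hv => ⟨hv.1, (le_max_right _ _).trans_lt hv.2⟩
      have hle : ∫ v in cone N p ε y, (u (z + v) - w (z + v)) ∂(fracMeasure N s) ≤
          ∫ v in cone N p ε y, (S - (cone N p R y).indicator (fun _ => S) v)
            ∂(fracMeasure N s) := by
        have hi1 := (integrableOn_cone_comp_add (p := p) hN hp hs hε hy hdm hdb z)
        refine integral_mono_ae hi1
          ((integrable_const S).sub ((integrable_const S).indicator hcm)) ?_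
        refine (ae_restrict_iff' (measurableSet_cone hN hp ε hy)).2
          (Eventually.of_forall fun v hv => ?_)
        by_cases hvR : v ∈ cone N p R y
        · simp only [Set.indicator_of_mem hvR, sub_self]
          have : z + v ∉ E := fun h => absurd (hjump z hz v h) (not_le.2 hvR.2)
          linarith [hout _ this]
        · simp only [Set.indicator_of_notMem hvR, sub_zero]
          exact le_ciSup hbdd (z + v)
      rw [integral_sub (integrable_const S) ((integrable_const S).indicator hcm),
        integral_indicator hcm, Measure.restrict_restrict hcm,
        Set.inter_eq_self_of_subset_left hsubset, integral_const, integral_const,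
        measureReal_restrict_apply_univ, measureReal_restrict_apply_univ, hmR, smul_eq_mul,
        smul_eq_mul, integral_sub (integrableOn_cone_comp_add hN hp hs hε hy hu hM z)
          (integrableOn_cone_comp_add hN hp hs hε hy hw hM' z)] at hle
      rw [coneAvg_eq, coneAvg_eq, ← sub_le_iff_le_add', ← mul_sub, inv_mul_le_iff₀ hm]
      linarith
    have := hsub z hz
    have := hsup z hz
    simp only [hd]
    linarith
  have hq1 : q ≤ 1 := by
    rw [hq, div_le_one (Real.rpow_pos_of_pos hRpos _)]
    exact Real.rpow_le_rpow hε.le (le_max_right _ _) (by linarith [hs.1])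
  -- The bound `S ≤ (1 - q) * S` contradicts `0 < S` and `0 < q`.
  have : S ≤ (1 - q) * S := by
    refine ciSup_le fun z => ?_
    by_cases hz : z ∈ E
    · exact hstep z hz
    · exact (sub_nonpos.2 (hout z hz)).trans (mul_nonneg (by linarith) hSpos.le)
  nlinarith

theorem avgOp_const (hN : 2 ≤ N) (hp : 2 ≤ p) (hs : s ∈ Set.Ioo (1 / 2 : ℝ) 1)
    {ε : ℝ} (hε : 0 < ε) (c : ℝ) (x : Rn N) : avgOp N p s ε (fun _ => c) x = c := by
  have h : ∀ y : sphere (0 : Rn N) 1, coneAvg N p s ε (fun _ => c) x y = c := fun y => by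
    have hm := real_cone_pos (p := p) hN hp hs hε (norm_coe_sphere y)
    rw [coneAvg_eq, integral_const, measureReal_restrict_apply_univ, smul_eq_mul,
      inv_mul_cancel_left₀ hm.ne']
  simp only [avgOp_eq, h, ciSup_const, ciInf_const]
  ring

theorem avgOp_add_const (hN : 2 ≤ N) (hp : 2 ≤ p) (hs : s ∈ Set.Ioo (1 / 2 : ℝ) 1)
    {ε : ℝ} (hε : 0 < ε) {u : Rn N → ℝ} (hu : Measurable u) {M : ℝ} (hM : ∀ z, |u z| ≤ M)
    (c : ℝ) (x : Rn N) :
    avgOp N p s ε (fun z => u z + c) x ≤ avgOp N p s ε u x + c :=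
  avgOp_mono_add hN hp hs hε (hu.add_const c) hu (M := M + |c|)
    (fun z => (abs_add_le _ _).trans (add_le_add_left (hM z) _)) hM (fun _ => le_rfl) x

/-! ### Solutions of the dynamic programming principle -/

variable {D : Set (Rn N)} {F : Rn N → ℝ} {ε : ℝ} {u : Rn N → ℝ}

theorem IsDPPSolution.neg (h : IsDPPSolution N p s D F ε u) :
    IsDPPSolution N p s D (fun z => -F z) ε (fun z => -u z) where
  measurable := h.measurable.neg
  bounded := by simpa using h.bounded
  eq_avg x hx := by rw [avgOp_neg, ← h.eq_avg x hx]
  eq_data x hx := by rw [h.eq_data x hx]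

theorem IsDPPSolution.le_of_data_le (hN : 2 ≤ N) (hp : 2 ≤ p) (hs : s ∈ Set.Ioo (1 / 2 : ℝ) 1)
    (hε : 0 < ε) (hD : Bornology.IsBounded D) (h : IsDPPSolution N p s D F ε u) {M : ℝ}
    (hM : ∀ x, F x ≤ M) (x : Rn N) : u x ≤ M := by
  obtain ⟨M', hM'⟩ := h.bounded
  exact le_of_le_avgOp (p := p) hN hp hs hε hD h.measurable measurable_const hM' (w := fun _ => M)
    (M' := |M|) (fun _ => le_rfl) (fun x hx => (h.eq_avg x hx).le)
    (fun x _ => (avgOp_const hN hp hs hε M x).le)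
    (fun x hx => (h.eq_data x hx).le.trans (hM x)) x

theorem IsDPPSolution.abs_le_of_data (hN : 2 ≤ N) (hp : 2 ≤ p) (hs : s ∈ Set.Ioo (1 / 2 : ℝ) 1)
    (hε : 0 < ε) (hD : Bornology.IsBounded D) (h : IsDPPSolution N p s D F ε u) {M : ℝ}
    (hM : ∀ x, |F x| ≤ M) (x : Rn N) : |u x| ≤ M := by
  refine abs_le.2 ⟨?_, h.le_of_data_le hN hp hs hε hD (fun x => (abs_le.1 (hM x)).2) x⟩
  have := h.neg.le_of_data_le hN hp hs hε hD (M := M)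
    (fun x => by linarith [(abs_le.1 (hM x)).1]) x
  linarith

end

noncomputable section

/-! ### A logarithmic barrier -/

/-- The logarithmic profile of the barrier. -/
def logProfile {N : ℕ} (κ δ : ℝ) (a v : Rn N) : ℝ := 1 + κ * Real.log (1 + ‖v - a‖ ^ 2 / δ ^ 2)

theorem log_one_add_sq_nonneg (t δ : ℝ) : 0 ≤ Real.log (1 + t ^ 2 / δ ^ 2) :=
  Real.log_nonneg (by have : 0 ≤ t ^ 2 / δ ^ 2 := by positivity
                      linarith)

theorem one_le_logProfile {N : ℕ} {κ : ℝ} (hκ : 0 ≤ κ) (δ : ℝ) (a v : Rn N) :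
    1 ≤ logProfile κ δ a v :=
  le_add_of_nonneg_right (mul_nonneg hκ (log_one_add_sq_nonneg _ _))

theorem log_one_add_sq_mono {t t' δ : ℝ} (ht : 0 ≤ t) (h : t ≤ t') :
    Real.log (1 + t ^ 2 / δ ^ 2) ≤ Real.log (1 + t' ^ 2 / δ ^ 2) :=
  Real.log_le_log (by positivity) (by gcongr)

theorem measurable_logProfile {N : ℕ} (κ δ : ℝ) (a : Rn N) : Measurable (logProfile κ δ a) := by
  unfold logProfile
  exact ((Real.measurable_log.comp (by fun_prop)).const_mul κ).const_add 1

/-- The remainder depends only on the relative jump length `‖z‖ / ‖x - a‖`, with a constant free of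
`δ`. This scale invariance is what the logarithm is chosen for. -/
theorem logProfile_add_sub_le {N : ℕ} {κ δ : ℝ} (hκ : 0 ≤ κ) (hδ : 0 < δ) {a x : Rn N}
    (hx : 0 < ‖x - a‖) (z : Rn N) :
    logProfile κ δ a (x + z) - logProfile κ δ a x ≤
      κ * (2 / (δ ^ 2 + ‖x - a‖ ^ 2) * ⟪x - a, z⟫ + 4 * levyWeight (‖z‖ / ‖x - a‖)) := by
  have hadd : x + z - a = (x - a) + z := by abel
  unfold logProfile
  rw [hadd]
  generalize x - a = X at hx ⊢
  rw [add_sub_add_left_eq_sub, ← mul_sub]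
  refine mul_le_mul_of_nonneg_left ?_ hκ
  set R := ‖X‖ with hR
  set T := δ ^ 2 + R ^ 2 with hT
  have hδ2 : 0 < δ ^ 2 := by positivity
  have hTpos : 0 < T := by positivity
  have hTR : R ^ 2 ≤ T := by linarith
  set t := ‖z‖ / R with ht
  have ht0 : 0 ≤ t := by positivity
  have hzt : ‖z‖ = t * R := by rw [ht]; field_simp
  have hn : ‖X + z‖ ^ 2 = R ^ 2 + 2 * ⟪X, z⟫ + ‖z‖ ^ 2 := norm_add_sq_real X z
  have hq : Real.log (1 + ‖X + z‖ ^ 2 / δ ^ 2) - Real.log (1 + R ^ 2 / δ ^ 2) =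
      Real.log ((δ ^ 2 + ‖X + z‖ ^ 2) / T) := by
    rw [← Real.log_div (by positivity) (by positivity)]
    congr 1
    rw [hT]
    field_simp
  have hqpos : 0 < (δ ^ 2 + ‖X + z‖ ^ 2) / T := by positivity
  rw [hq]
  -- Short jumps: `log q ≤ q - 1` is exactly the linear term plus `‖z‖² / T ≤ t²`. Long jumps: the
  -- logarithm is at most `2 log (1 + t) ≤ 2 t` and the linear term is at least `-2 t`, whence the
  -- constant `4`.
  rcases le_total t 1 with h1 | h1
  · rw [levyWeight_of_le_one ht0 h1]
    have h2 := Real.log_le_sub_one_of_pos hqpos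
    have h3 : (δ ^ 2 + ‖X + z‖ ^ 2) / T - 1 = 2 / T * ⟪X, z⟫ + ‖z‖ ^ 2 / T := by
      rw [hn]
      field_simp
      rw [hT]
      ring
    have h4 : ‖z‖ ^ 2 / T ≤ t ^ 2 := by
      rw [div_le_iff₀ hTpos, hzt, mul_pow]
      exact mul_le_mul_of_nonneg_left hTR (sq_nonneg t)
    nlinarith [sq_nonneg t]
  · rw [levyWeight_of_one_le h1]
    have hin := abs_le.1 (abs_real_inner_le_norm X z)
    have hRt : R * ‖z‖ ≤ t * T := by
      rw [hzt]
      nlinarith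
    have h2 : (δ ^ 2 + ‖X + z‖ ^ 2) / T ≤ (1 + t) ^ 2 := by
      rw [div_le_iff₀ hTpos, hn]
      have : ‖z‖ ^ 2 ≤ t ^ 2 * T := by
        rw [hzt, mul_pow]
        exact mul_le_mul_of_nonneg_left hTR (sq_nonneg t)
      nlinarith [hin.2]
    have h3 : Real.log ((δ ^ 2 + ‖X + z‖ ^ 2) / T) ≤ 2 * t := by
      refine (Real.log_le_log hqpos h2).trans ?_
      rw [Real.log_pow]
      have := Real.log_le_sub_one_of_pos (show 0 < 1 + t by linarith)
      push_cast
      linarith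
    have h4 : -(2 * t) ≤ 2 / T * ⟪X, z⟫ := by
      rw [div_mul_eq_mul_div, le_div_iff₀ hTpos]
      nlinarith [hin.1]
    linarith

/-- Moving the axis point `l • d` by at most `t * l` leaves an axial component of at least `(1 - t)
l` and a norm of at most `(1 + t) l`. It serves both the averaging cone and the exterior cone. -/
theorem add_mem_cone {N : ℕ} {c t l : ℝ} {d w : Rn N} (hd : ‖d‖ = 1) (h0 : 0 ≤ c)
    (hc : c * (1 + t) < 1 - t) (hl : 0 < l) (hw : ‖w‖ ≤ t * l) :
    c * ‖l • d + w‖ < ⟪d, l • d + w⟫ ∧ (1 - t) * l ≤ ‖l • d + w‖ ∧ ‖l • d + w‖ ≤ (1 + t) * l := by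
  have hld : ‖l • d‖ = l := by rw [norm_smul, hd, Real.norm_of_nonneg hl.le, mul_one]
  have h1 : ‖l • d + w‖ ≤ (1 + t) * l := by
    have := norm_add_le (l • d) w
    rw [hld] at this
    linarith
  have h2 : (1 - t) * l ≤ ⟪d, l • d + w⟫ := by
    rw [inner_add_right, real_inner_smul_right, real_inner_self_eq_norm_sq, hd]
    have := (abs_le.1 (abs_real_inner_le_norm d w)).1
    rw [hd] at this
    linarith
  have h3 : ⟪d, l • d + w⟫ ≤ ‖l • d + w‖ := by
    have := real_inner_le_norm d (l • d + w)
    rwa [hd, one_mul] at this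
  refine ⟨?_, h2.trans h3, h1⟩
  have := mul_le_mul_of_nonneg_left h1 h0
  nlinarith

variable {N : ℕ} [NeZero N] {p s : ℝ}

/-- Balls of radius comparable to their distance from the origin have mass at least `c R^{-2s}`. -/
theorem exists_le_fracMeasure_ball (hs0 : 0 < s) (hs1 : s < 1) {ρ : ℝ} (hρ : 0 < ρ) :
    ∃ c : ℝ, 0 < c ∧ ∀ R : ℝ, 0 < R → ∀ v : Rn N, (∀ z ∈ ball v (ρ * R), 0 < ‖z‖ ∧ ‖z‖ ≤ 2 * R) →
      fracMeasure N s (ball v (ρ * R)) < ⊤ →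
      (R ^ (2 * s))⁻¹ * c ≤ (fracMeasure N s).real (ball v (ρ * R)) := by
  -- The value of the density at norm `2`, hence a lower bound for it on the rescaled ball.
  set c₀ := fracConst N s / 2 ^ ((N : ℝ) + 2 * s) with hc₀
  have hC := fracConst_pos (N := N) hs0 hs1
  have hc₀pos : 0 < c₀ := by positivity
  have hvol : 0 < (volume : Measure (Rn N)).real (ball 0 ρ) :=
    ENNReal.toReal_pos (measure_ball_pos _ _ hρ).ne' measure_ball_lt_top.ne
  refine ⟨c₀ * (volume : Measure (Rn N)).real (ball 0 ρ), by positivity, fun R hR v hz hfin => ?_⟩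
  have hRs := Real.rpow_pos_of_pos hR (2 * s)
  have hscale := integral_comp_smul_fracMeasure (N := N) hs0 hs1
    ((ball v (ρ * R)).indicator fun _ => (1 : ℝ)) hR
  have hmem : ∀ z : Rn N, R • z ∈ ball v (ρ * R) ↔ z ∈ ball (R⁻¹ • v) ρ := by
    intro z
    rw [mem_ball_iff_norm, mem_ball_iff_norm]
    have : R • z - v = R • (z - R⁻¹ • v) := by rw [smul_sub, smul_inv_smul₀ hR.ne']
    rw [this, norm_smul, Real.norm_of_nonneg hR.le, mul_comm ρ, mul_lt_mul_iff_right₀ hR]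
  have hind : ∀ z : Rn N, (ball v (ρ * R)).indicator (fun _ => (1 : ℝ)) (R • z) =
      (ball (R⁻¹ • v) ρ).indicator (fun _ => (1 : ℝ)) z := by
    intro z
    by_cases h : z ∈ ball (R⁻¹ • v) ρ
    · rw [Set.indicator_of_mem h, Set.indicator_of_mem ((hmem z).2 h)]
    · rw [Set.indicator_of_notMem h, Set.indicator_of_notMem fun h' => h ((hmem z).1 h')]
  simp only [hind] at hscale
  rw [integral_indicator measurableSet_ball, integral_indicator measurableSet_ball,
    integral_const, integral_const, smul_eq_mul, smul_eq_mul, mul_one, mul_one,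
    measureReal_restrict_apply_univ, measureReal_restrict_apply_univ] at hscale
  rw [inv_mul_le_iff₀ hRs, ← hscale]
  have hlow : ENNReal.ofReal c₀ * volume (ball (R⁻¹ • v) ρ) ≤
      fracMeasure N s (ball (R⁻¹ • v) ρ) := by
    unfold fracMeasure
    rw [withDensity_apply _ measurableSet_ball, ← setLIntegral_const]
    refine setLIntegral_mono (measurable_fracDensity N s) fun z hzb => ?_
    refine ENNReal.ofReal_le_ofReal ?_
    obtain ⟨h1, h2⟩ := hz _ ((hmem z).2 hzb)
    rw [norm_smul, Real.norm_of_nonneg hR.le] at h1 h2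
    have h3 : 0 < ‖z‖ := pos_of_mul_pos_right h1 hR.le
    have h4 : ‖z‖ ≤ 2 := by nlinarith
    rw [hc₀]
    gcongr
  rw [Measure.addHaar_ball_center] at hlow
  -- `Measure.real` sends infinite mass to `0`. If the rescaled ball had infinite mass, the scaling
  -- identity would give zero mass to the original ball, which is open and nonempty.
  have hfin' : fracMeasure N s (ball (R⁻¹ • v) ρ) ≠ ⊤ := by
    intro htop
    have hpre : ball (R⁻¹ • v) ρ = (fun z : Rn N => R • z) ⁻¹' ball v (ρ * R) := by
      ext z; exact (hmem z).symm
    have h0 : (fracMeasure N s).real (ball v (ρ * R)) = 0 := by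
      have : (fracMeasure N s).real (ball (R⁻¹ • v) ρ) = 0 := by
        simp [Measure.real, htop]
      rw [this] at hscale
      exact (mul_eq_zero.1 hscale.symm).resolve_left hRs.ne'
    have h1 : fracMeasure N s (ball v (ρ * R)) = 0 := by
      rcases (ENNReal.toReal_eq_zero_iff _).1 h0 with h | h
      · exact h
      · exact absurd h hfin.ne
    exact (fracMeasure_pos_of_isOpen hs0 hs1 isOpen_ball
      (nonempty_ball.2 (by positivity))).ne' h1
  have := ENNReal.toReal_mono hfin' hlow
  rwa [ENNReal.toReal_mul, ENNReal.toReal_ofReal hc₀pos.le] at this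

theorem exists_aperture_margin {c : ℝ} (h0 : 0 ≤ c) (h1 : c < 1) :
    ∃ t : ℝ, 0 < t ∧ t ≤ 1 / 4 ∧ c * (1 + t) < 1 - t :=
  ⟨(1 - c) / 4, by linarith, by linarith, by nlinarith⟩

/-- A function that lies below a logarithmic profile of small slope, touches it at `x`, and
vanishes on a ball near the centre is a supersolution at `x`. -/
theorem exists_avgOp_le_of_hole (hN : 2 ≤ N) (hp : 2 ≤ p) (hs : s ∈ Set.Ioo (1 / 2 : ℝ) 1)
    {t ρ : ℝ} (ht : t ≤ 1 / 4) (htc : coneCos N p * (1 + t) < 1 - t) (hρ : 0 < ρ) :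
    ∃ κ : ℝ, 0 < κ ∧ ∀ (W : Rn N → ℝ) (M : ℝ) (a x b : Rn N) (δ ε : ℝ), Measurable W →
      (∀ v, |W v| ≤ M) → 0 < δ → 0 < ε → ε < ‖x - a‖ / 2 →
      ‖b‖ + ρ * ‖x - a‖ ≤ t * ‖x - a‖ → (∀ v, W v ≤ logProfile κ δ a v) →
      W x = logProfile κ δ a x → (∀ v ∈ ball (a + b) (ρ * ‖x - a‖), W v = 0) →
      avgOp N p s ε W x ≤ W x := by
  have hs0 : 0 < s := by linarith [hs.1]
  obtain ⟨c, hcpos, hc⟩ := exists_le_fracMeasure_ball (N := N) hs0 hs.2 hρ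
  set H := ∫ z : Rn N, levyWeight ‖z‖ ∂(fracMeasure N s) with hH
  have hHnn : 0 ≤ H := integral_nonneg fun z => levyWeight_nonneg (norm_nonneg z)
  -- Chosen so that `8 κ H ≤ c`, with `H + 1` to keep the denominator positive. It is fixed before
  -- `δ`, `ε` and all the points.
  set κ := c / (8 * (H + 1)) with hκ
  have hκpos : 0 < κ := by positivity
  refine ⟨κ, hκpos, ?_⟩
  intro W M a x b δ ε hWm hWM hδ hε hεR hb hWL hWx hW0
  set X := x - a with hX
  set R := ‖X‖ with hR
  have hRpos : 0 < R := by linarith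
  have hRs := Real.rpow_pos_of_pos hRpos (2 * s)
  set T := δ ^ 2 + R ^ 2 with hT
  have hTpos : 0 < T := by positivity
  -- The outward radial direction; `-e` is the trial direction for the infimum.
  set e : Rn N := R⁻¹ • X with he
  have he1 : ‖e‖ = 1 := by
    rw [he, norm_smul, norm_inv, norm_norm, ← hR, inv_mul_cancel₀ hRpos.ne']
  have hne1 : ‖-e‖ = 1 := by rw [norm_neg, he1]
  -- The hole around `a + b` as seen from `x`.
  set B := ball (b - X) (ρ * R) with hB
  have hBgeom : ∀ z ∈ B, z ∈ cone N p ε (-e) ∧ 0 < ‖z‖ ∧ ‖z‖ ≤ 2 * R := by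
    intro z hz
    have hz' : ‖z - (b - X)‖ < ρ * R := mem_ball_iff_norm.1 hz
    have hw : ‖z + X‖ ≤ t * R := by
      have h1 : z + X = (z - (b - X)) + b := by abel
      rw [h1]
      exact (norm_add_le _ _).trans (by linarith)
    -- A point of the hole is the axis point at distance `R` in direction `-e`, moved by at most `t
    -- * R`; its distance is at least `3 R / 4 > ε`.
    have hzeq : z = R • (-e) + (z + X) := by
      rw [he, smul_neg, smul_inv_smul₀ hRpos.ne']; abel
    have h2 := add_mem_cone hne1 (coneCos_nonneg hN hp) htc hRpos hw
    rw [← hzeq] at h2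
    refine ⟨(mem_cone_iff hN hp hne1).2 ⟨h2.1, ?_⟩, ?_, ?_⟩ <;> nlinarith [h2.2.1, h2.2.2]
  have hBsub : B ⊆ cone N p ε (-e) := fun z hz => (hBgeom z hz).1
  have hBfin : fracMeasure N s B < ⊤ :=
    (measure_mono hBsub).trans_lt (fracMeasure_cone_lt_top hN hp hs hε hne1)
  have hBmass := hc R hRpos (b - X) (fun z hz => (hBgeom z hz).2) hBfin
  set G : Rn N → ℝ := fun z => κ * (2 / T * ⟪X, z⟫ + 4 * levyWeight (‖z‖ / R)) with hG
  have hlev := integrable_levyWeight_div (N := N) hs hRpos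
  have hGi : ∀ y : Rn N, ‖y‖ = 1 → IntegrableOn G (cone N p ε y) (fracMeasure N s) := fun y hy =>
    (((integrableOn_inner_cone hN hp hs hε hy X).const_mul _).add
      (hlev.integrableOn.const_mul 4)).const_mul κ
  set μ₁ := ε / ε ^ (2 * s) * coneMean N p s with hμ₁
  have hμ₁pos : 0 < μ₁ := by
    have := coneMean_pos hN hp hs
    have := Real.rpow_pos_of_pos hε (2 * s)
    positivity
  have hGint : ∀ y : Rn N, ‖y‖ = 1 → ∫ z in cone N p ε y, G z ∂(fracMeasure N s) ≤
      κ * (2 / T * (μ₁ * ⟪X, y⟫) + 4 * ((R ^ (2 * s))⁻¹ * H)) := by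
    intro y hy
    simp only [hG]
    rw [integral_const_mul, integral_add ((integrableOn_inner_cone hN hp hs hε hy X).const_mul _)
      (hlev.integrableOn.const_mul 4), integral_const_mul, integral_const_mul,
      integral_inner_cone hN hp hs hε hy, hH, ← integral_levyWeight_div hs0 hs.2 hRpos]
    gcongr
    · exact Eventually.of_forall fun z => levyWeight_nonneg (by positivity)
    · exact Measure.restrict_le_self
  have hLG : ∀ z, logProfile κ δ a (x + z) - logProfile κ δ a x ≤ G z := fun z =>
    logProfile_add_sub_le hκpos.le hδ hRpos z
  have hWi : ∀ y : Rn N, ‖y‖ = 1 →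
      IntegrableOn (fun z => W (x + z) - W x) (cone N p ε y) (fracMeasure N s) := fun y hy =>
    integrableOn_cone_of_bounded hN hp hs hε hy ((hWm.comp (measurable_const_add x)).sub_const _)
      (M := M + M) fun z => (abs_sub _ _).trans (add_le_add (hWM _) (hWM _))
  -- The first order term `μ₁ * R`, the worst over all directions, is cancelled exactly by the term
  -- `μ₁ * (-R)` of direction `-e` in `hdown`.
  have hup : ∀ y : Rn N, ‖y‖ = 1 → ∫ z in cone N p ε y, (W (x + z) - W x) ∂(fracMeasure N s) ≤
      κ * (2 / T * (μ₁ * R) + 4 * ((R ^ (2 * s))⁻¹ * H)) := by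
    intro y hy
    refine (integral_mono (hWi y hy) (hGi y hy) fun z => ?_).trans ((hGint y hy).trans ?_)
    · simp only
      rw [hWx]
      linarith [hLG z, hWL (x + z)]
    · have : ⟪X, y⟫ ≤ R := by
        have := real_inner_le_norm X y
        rwa [hy, mul_one] at this
      gcongr
  have hdown : ∫ z in cone N p ε (-e), (W (x + z) - W x) ∂(fracMeasure N s) ≤
      κ * (2 / T * (μ₁ * (-R)) + 4 * ((R ^ (2 * s))⁻¹ * H)) - (R ^ (2 * s))⁻¹ * c := by
    have hf := fracMeasure_cone_lt_top (s := s) (p := p) hN hp hs hε hne1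
    have : IsFiniteMeasure ((fracMeasure N s).restrict (cone N p ε (-e))) := ⟨by simpa using hf⟩
    have hi : Integrable (B.indicator fun _ => (1 : ℝ))
        ((fracMeasure N s).restrict (cone N p ε (-e))) :=
      (integrable_const 1).indicator measurableSet_ball
    refine (integral_mono (hWi _ hne1) ((hGi _ hne1).sub hi) fun z => ?_).trans ?_
    · simp only [Pi.sub_apply]
      rw [hWx]
      by_cases hz : z ∈ B
      · rw [Set.indicator_of_mem hz]
        have h0 : W (x + z) = 0 := by
          refine hW0 _ ?_
          rw [mem_ball_iff_norm]
          have : x + z - (a + b) = z - (b - X) := by rw [hX]; abel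
          rw [this]
          exact mem_ball_iff_norm.1 hz
        -- On the hole `W` vanishes while the profile is at least `1`: each such point gains a full
        -- unit.
        linarith [hLG z, one_le_logProfile hκpos.le δ a (x + z)]
      · rw [Set.indicator_of_notMem hz]
        linarith [hLG z, hWL (x + z)]
    · have h1 := hGint _ hne1
      have h2 : ⟪X, -e⟫ = -R := by
        rw [inner_neg_right, he, real_inner_smul_right, real_inner_self_eq_norm_sq, ← hR]
        field_simp
      rw [h2] at h1
      rw [integral_sub' (hGi _ hne1) hi, integral_indicator measurableSet_ball,
        Measure.restrict_restrict measurableSet_ball, Set.inter_eq_self_of_subset_left hBsub,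
        integral_const, measureReal_restrict_apply_univ, smul_eq_mul, mul_one]
      exact sub_le_sub h1 hBmass
  refine avgOp_le_of_forall hN hp hs hε hWM hne1 fun y hy => ?_
  have e1 := coneAvg_sub_const hN hp hs hε hy hWm hWM x (W x)
  have e2 := coneAvg_sub_const hN hp hs hε hne1 hWm hWM x (W x)
  have hm := real_cone_pos (p := p) hN hp hs hε hy
  rw [real_cone hN hp hs hε hne1, ← real_cone hN hp hs hε hy] at e2
  have hsum : (fracMeasure N s).real (cone N p ε y) *
      (coneAvg N p s ε W x y + coneAvg N p s ε W x (-e) - 2 * W x) ≤ 0 := by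
    have h1 := hup y hy
    have hfac : 8 * κ * H ≤ c := by
      rw [hκ]
      field_simp
      nlinarith
    have h3 : (R ^ (2 * s))⁻¹ * (8 * κ * H) ≤ (R ^ (2 * s))⁻¹ * c :=
      mul_le_mul_of_nonneg_left hfac (inv_pos.2 hRs).le
    calc _ = (fracMeasure N s).real (cone N p ε y) * (coneAvg N p s ε W x y - W x) +
        (fracMeasure N s).real (cone N p ε y) * (coneAvg N p s ε W x (-e) - W x) := by ring
      _ ≤ _ := by
        rw [e1, e2]
        refine (add_le_add h1 hdown).trans ?_
        linarith
  have := nonpos_of_mul_nonpos_right hsum hm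
  linarith

end

noncomputable section

/-! ### Boundary regularity -/

/-- The exterior cone condition provides balls of size proportional to the distance from the
boundary point along the axis of the cone. -/
theorem ExteriorCone.exists_ball_subset {N : ℕ} {D : Set (Rn N)} (h : ExteriorCone N D) :
    ∃ q h₀ : ℝ, 0 < q ∧ q ≤ 1 / 4 ∧ 0 < h₀ ∧ ∀ x ∈ frontier D, ∃ d : Rn N, ‖d‖ = 1 ∧
      ∀ l : ℝ, 0 < l → 2 * l ≤ h₀ → ∀ v ∈ ball (x + l • d) (q * l),
        v ∉ D ∧ ‖v - x‖ < 2 * l := by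
  obtain ⟨θ, h₀, hθ, hh, hD⟩ := h
  have hpi := Real.pi_gt_three
  -- Shrinking the opening below `π / 2` makes the cosine criterion for the angle available.
  set θ' := min θ 1 with hθ'
  have hθ'0 : 0 < θ' := lt_min hθ one_pos
  have hθ'1 : θ' ≤ 1 := min_le_right _ _
  have hc0 : 0 ≤ Real.cos θ' := Real.cos_nonneg_of_mem_Icc ⟨by linarith, by linarith⟩
  have hc1 : Real.cos θ' < 1 := by
    rw [← Real.cos_zero]
    exact Real.cos_lt_cos_of_nonneg_of_le_pi_div_two le_rfl (by linarith) hθ'0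
  obtain ⟨q, hq0, hq1, hq⟩ := exists_aperture_margin hc0 hc1
  refine ⟨q, h₀, hq0, hq1, hh, fun x hx => ?_⟩
  obtain ⟨d, hd, hcone⟩ := hD x hx
  refine ⟨d, hd, fun l hl hlh v hv => ?_⟩
  have hw : ‖v - (x + l • d)‖ ≤ q * l := (mem_ball_iff_norm.1 hv).le
  have hg := add_mem_cone hd hc0 hq hl hw
  have hveq : l • d + (v - (x + l • d)) = v - x := by abel
  rw [hveq] at hg
  have hlt : ‖v - x‖ < 2 * l := by nlinarith [hg.2.2]
  have hpos : 0 < ‖v - x‖ := by nlinarith [hg.2.1]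
  have hang := (angle_lt_iff_of_norm_eq_one (z := v - x) hd hθ'0 (by linarith)).2 hg.1
  have := hcone (v - x) (hang.trans_le (min_le_left _ _)) hpos (by linarith)
  rw [add_sub_cancel] at this
  exact ⟨this, hlt⟩

variable {N : ℕ} [NeZero N] {p s : ℝ}

theorem avgOp_const_mul {A : ℝ} (hA : 0 ≤ A) (ε : ℝ) (u : Rn N → ℝ) (x : Rn N) :
    avgOp N p s ε (fun z => A * u z) x = A * avgOp N p s ε u x := by
  have h : ∀ y, coneAvg N p s ε (fun z => A * u z) x y = A * coneAvg N p s ε u x y := fun y => by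
    rw [coneAvg_eq, coneAvg_eq, integral_const_mul]
    ring
  simp only [avgOp_eq, h]
  rw [← Real.mul_iSup_of_nonneg hA, ← Real.mul_iInf_of_nonneg hA]
  ring

set_option maxHeartbeats 400000 in
/-- One-sided boundary estimate, uniform in the boundary point and in small `ε`. -/
theorem exists_boundary_bound (hN : 2 ≤ N) (hp : 2 ≤ p) (hs : s ∈ Set.Ioo (1 / 2 : ℝ) 1)
    {D : Set (Rn N)} (hDo : IsOpen D) (hDb : Bornology.IsBounded D) (hDc : ExteriorCone N D)
    {F : Rn N → ℝ} {M : ℝ} (hM : ∀ x, |F x| ≤ M) (hFu : UniformContinuous F) {η : ℝ}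
    (hη : 0 < η) : ∃ δ : ℝ, 0 < δ ∧ ∃ ε₀ : ℝ, 0 < ε₀ ∧ ∀ (ε : ℝ) (u : Rn N → ℝ), 0 < ε → ε < ε₀ →
      IsDPPSolution N p s D F ε u → ∀ x₀ ∈ frontier D, ∀ x, ‖x - x₀‖ < δ → u x ≤ F x₀ + η := by
  obtain ⟨q, h₀, hq0, hq1, hh, hball⟩ := hDc.exists_ball_subset
  obtain ⟨t, ht0, ht1, htc⟩ := exists_aperture_margin (coneCos_nonneg (N := N) hN hp)
    (coneCos_lt_one hN hp)
  -- Half of the margin places the centre of the hole; its radius, `q ≤ 1/4` times that offset, fits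
  -- in the other half.
  set τ := t / 2 with hτ
  have hτ0 : 0 < τ := by positivity
  obtain ⟨κ, hκ0, hκ⟩ := exists_avgOp_le_of_hole hN hp hs ht1 htc (ρ := q * τ) (by positivity)
  obtain ⟨r, hr0, hr⟩ := Metric.uniformContinuous_iff.1 hFu (η / 2) (by positivity)
  have hM0 : 0 ≤ M := (abs_nonneg _).trans (hM 0)
  -- Within `r₁` of the boundary point the data vary by less than `η / 2` and the exterior cone is
  -- still available.
  set r₁ := min r h₀ with hr₁
  have hr₁0 : 0 < r₁ := lt_min hr0 hh
  have hlog5 : 0 < Real.log 5 := Real.log_pos (by norm_num)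
  -- Makes `A (1 + κ log 5) = η / 2`; the bracket is the value of the profile at distance `2 δ` from
  -- its centre.
  set A := η / (2 * (1 + κ * Real.log 5)) with hA
  have hA0 : 0 < A := by positivity
  -- `A κ b₀ = 2 M` and `exp b₀ * δ = r₁ / 4`, so the scaled profile has reached `2 M` at distance
  -- `r₁ - δ` from its centre.
  set b₀ := 2 * M / (A * κ) with hb₀
  have hb₀0 : 0 ≤ b₀ := by positivity
  set δ := r₁ / 4 * Real.exp (-b₀) with hδ
  have hδ0 : 0 < δ := by positivity
  have hδr : δ ≤ r₁ / 4 := by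
    rw [hδ]
    have : Real.exp (-b₀) ≤ 1 := Real.exp_le_one_iff.2 (by linarith)
    nlinarith
  -- Points of `D` are at distance at least `q * δ` from the barrier's centre, so `ε < q * δ / 2`
  -- gives `ε < ‖v - a‖ / 2` there.
  refine ⟨δ, hδ0, q * δ / 2, by positivity, fun ε u hε hεδ hu x₀ hx₀ x hx => ?_⟩
  obtain ⟨d, hd, hdball⟩ := hball x₀ hx₀
  set a := x₀ + δ • d with ha
  have hax₀ : ‖a - x₀‖ = δ := by
    rw [ha, add_sub_cancel_left, norm_smul, hd, mul_one, Real.norm_of_nonneg hδ0.le]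
  have hdistle : ∀ v, ‖v - a‖ ≤ ‖v - x₀‖ + δ := fun v => by
    have h1 := norm_sub_le (v - x₀) (a - x₀)
    rwa [sub_sub_sub_cancel_right, hax₀] at h1
  have hdistge : ∀ v, ‖v - x₀‖ - δ ≤ ‖v - a‖ := fun v => by
    have h1 := norm_add_le (v - a) (a - x₀)
    rw [sub_add_sub_cancel, hax₀] at h1
    linarith
  have hr₁h : r₁ ≤ h₀ := min_le_right _ _
  have hcenter : ∀ v ∈ D, q * δ ≤ ‖v - a‖ := fun v hv => by
    by_contra hcon
    exact (hdball δ hδ0 (by linarith) v (mem_ball_iff_norm.2 (not_le.1 hcon))).1 hv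
  -- the barrier
  set cap := logProfile κ δ a (a + (r₁ + δ) • d) with hcap
  have hcapv : cap = 1 + κ * Real.log (1 + (r₁ + δ) ^ 2 / δ ^ 2) := by
    rw [hcap, logProfile, add_sub_cancel_left, norm_smul, hd, mul_one,
      Real.norm_of_nonneg (by linarith)]
  -- On `Z` the datum is already below `F x₀ + η / 2`, so the barrier may be set to zero there; this
  -- creates the hole.
  set Z : Set (Rn N) := Dᶜ ∩ ball x₀ r₁ with hZ
  have hZm : MeasurableSet Z := hDo.measurableSet.compl.inter measurableSet_ball
  set W : Rn N → ℝ := Zᶜ.indicator fun v => min (logProfile κ δ a v) cap with hW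
  have hWm : Measurable W := ((measurable_logProfile κ δ a).min measurable_const).indicator hZm.compl
  have hL1 := fun v => one_le_logProfile hκ0.le δ a v
  have hcap1 : 1 ≤ cap := hL1 _
  have hWZ : ∀ v ∈ Z, W v = 0 := fun v hv => Set.indicator_of_notMem (by simpa using hv) _
  have hWnZ : ∀ v, v ∉ Z → W v = min (logProfile κ δ a v) cap := fun v hv =>
    Set.indicator_of_mem (by simpa using hv) _
  have hW0 : ∀ v, 0 ≤ W v := fun v => by
    by_cases hv : v ∈ Z
    · rw [hWZ v hv]
    · rw [hWnZ v hv]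
      exact le_min (by linarith [hL1 v]) (by linarith)
  have hWL : ∀ v, W v ≤ logProfile κ δ a v := fun v => by
    by_cases hv : v ∈ Z
    · rw [hWZ v hv]
      linarith [hL1 v]
    · rw [hWnZ v hv]
      exact min_le_left _ _
  have hWcap : ∀ v, |W v| ≤ cap := fun v => by
    rw [abs_of_nonneg (hW0 v)]
    by_cases hv : v ∈ Z
    · rw [hWZ v hv]
      linarith
    · rw [hWnZ v hv]
      exact min_le_right _ _
  have hfar : ∀ v, r₁ ≤ ‖v - x₀‖ → 2 * M ≤ A * W v := fun v hv => by
    have hvZ : v ∉ Z := fun h => absurd (mem_ball_iff_norm.1 h.2) (not_lt.2 hv)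
    have hbase : 2 * M / A ≤ 1 + κ * Real.log (1 + (r₁ - δ) ^ 2 / δ ^ 2) := by
      have h1 : b₀ ≤ Real.log (1 + (r₁ - δ) ^ 2 / δ ^ 2) := by
        rw [Real.le_log_iff_exp_le (by positivity)]
        have h2 : Real.exp b₀ ≤ (r₁ - δ) / δ := by
          rw [le_div_iff₀ hδ0]
          have : Real.exp b₀ * δ = r₁ / 4 := by
            rw [hδ, Real.exp_neg]
            field_simp
          linarith
        have h3 : 1 ≤ Real.exp b₀ := Real.one_le_exp hb₀0
        rw [← div_pow]
        have h5 := pow_le_pow_left₀ (Real.exp_pos b₀).le h2 2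
        nlinarith
      have h2 : 2 * M / A = κ * b₀ := by
        rw [hb₀]
        field_simp
      rw [h2]
      exact (mul_le_mul_of_nonneg_left h1 hκ0.le).trans (le_add_of_nonneg_left zero_le_one)
    have h3 : 2 * M / A ≤ W v := by
      rw [hWnZ v hvZ]
      refine le_min (hbase.trans ?_) (hbase.trans ?_)
      · unfold logProfile
        have := log_one_add_sq_mono (δ := δ) (by linarith : 0 ≤ r₁ - δ)
          (by linarith [hdistge v] : r₁ - δ ≤ ‖v - a‖)
        gcongr
      · rw [hcapv]
        have := log_one_add_sq_mono (δ := δ) (by linarith : 0 ≤ r₁ - δ)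
          (by linarith : r₁ - δ ≤ r₁ + δ)
        gcongr
    rwa [div_le_iff₀' hA0] at h3
  set w : Rn N → ℝ := fun v => A * W v + (F x₀ + η / 2) with hw
  have hAW : Measurable fun v => A * W v := hWm.const_mul A
  have hAWb : ∀ v, |A * W v| ≤ A * cap := fun v => by
    rw [abs_mul, abs_of_pos hA0]
    exact mul_le_mul_of_nonneg_left (hWcap v) hA0.le
  have hub := hu.abs_le_of_data hN hp hs hε hDb hM
  have hcomp : u x ≤ w x := by
    refine le_of_le_avgOp hN hp hs hε (E := D ∩ ball x₀ r₁) (hDb.subset Set.inter_subset_left)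
      hu.measurable (hAW.add_const _) hub (w := w) (M' := A * cap + |F x₀ + η / 2|)
      (fun v => (abs_add_le _ _).trans (add_le_add_left (hAWb v) _))
      (fun v hv => (hu.eq_avg v hv.1).le) (fun v hv => ?_) (fun v hv => ?_) x
    · refine (avgOp_add_const hN hp hs hε hAW hAWb _ v).trans ?_
      rw [avgOp_const_mul hA0.le]
      refine add_le_add_left (mul_le_mul_of_nonneg_left ?_ hA0.le) _
      have hvx := mem_ball_iff_norm.1 hv.2
      have hva := hcenter v hv.1
      have hvZ : v ∉ Z := fun h => h.1 hv.1
      have hRle : ‖v - a‖ ≤ 5 / 4 * r₁ := by linarith [hdistle v]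
      have hRpos : 0 < ‖v - a‖ := lt_of_lt_of_le (by positivity) hva
      -- The hole seen from `v` is centred on the exterior axis, at `x₀ + (δ + τ ‖v - a‖) d`, and
      -- lies in `Z` by the exterior cone condition.
      refine hκ W cap a v ((τ * ‖v - a‖) • d) δ ε hWm hWcap hδ0 hε (by linarith) ?_ hWL ?_ ?_
      · rw [norm_smul, hd, mul_one, Real.norm_of_nonneg (by positivity), hτ]
        have h1 : q * (t / 2) * ‖v - a‖ ≤ 1 / 4 * (t / 2) * ‖v - a‖ := by gcongr
        linarith [mul_pos ht0 hRpos]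
      · rw [hWnZ v hvZ, min_eq_left]
        rw [hcapv, logProfile]
        have := log_one_add_sq_mono (δ := δ) (norm_nonneg (v - a))
          (by linarith [hdistle v] : ‖v - a‖ ≤ r₁ + δ)
        gcongr
      · intro v' hv'
        refine hWZ v' ?_
        have hl : 0 < δ + τ * ‖v - a‖ := by positivity
        have hτ1 : τ ≤ 1 / 8 := by rw [hτ]; linarith
        have hτR : τ * ‖v - a‖ ≤ 1 / 8 * (5 / 4 * r₁) :=
          mul_le_mul hτ1 hRle hRpos.le (by norm_num)
        have hl2 : 2 * (δ + τ * ‖v - a‖) ≤ r₁ := by linarith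
        have hmem : v' ∈ ball (x₀ + (δ + τ * ‖v - a‖) • d) (q * (δ + τ * ‖v - a‖)) := by
          rw [add_smul, ← add_assoc, ← ha]
          refine ball_subset_ball ?_ hv'
          rw [mul_assoc]
          exact mul_le_mul_of_nonneg_left (le_add_of_nonneg_left hδ0.le) hq0.le
        have h1 := hdball _ hl (by linarith) v' hmem
        exact ⟨h1.1, mem_ball_iff_norm.2 (by linarith [h1.2])⟩
    · by_cases hvb : v ∈ ball x₀ r₁
      · have hvD : v ∉ D := fun h => hv ⟨h, hvb⟩
        rw [hu.eq_data v hvD, hw]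
        have hdist : dist v x₀ < r := (mem_ball.1 hvb).trans_le (min_le_left _ _)
        have h1 := hr hdist
        rw [Real.dist_eq] at h1
        have h2 := (abs_lt.1 h1).2
        have h3 := mul_nonneg hA0.le (hW0 v)
        simp only
        linarith
      · have h1 := hfar v (not_lt.1 fun h => hvb (mem_ball_iff_norm.2 h))
        have h2 := (abs_le.1 (hub v)).2
        have h3 := (abs_le.1 (hM x₀)).1
        simp only [hw]
        linarith
  have hWx : A * W x ≤ η / 2 := by
    have h1 : W x ≤ 1 + κ * Real.log 5 := by
      refine (hWL x).trans ?_
      unfold logProfile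
      have h2 : ‖x - a‖ ≤ 2 * δ := by linarith [hdistle x]
      have h3 := log_one_add_sq_mono (δ := δ) (norm_nonneg _) h2
      have h4 : 1 + (2 * δ) ^ 2 / δ ^ 2 = 5 := by field_simp; norm_num
      rw [h4] at h3
      gcongr
    calc A * W x ≤ A * (1 + κ * Real.log 5) := mul_le_mul_of_nonneg_left h1 hA0.le
      _ = η / 2 := by rw [hA]; field_simp
  simp only [hw] at hcomp
  linarith

/-- Two-sided boundary estimate, uniform in the boundary point and in small `ε`. -/
theorem exists_boundary_estimate (hN : 2 ≤ N) (hp : 2 ≤ p) (hs : s ∈ Set.Ioo (1 / 2 : ℝ) 1)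
    {D : Set (Rn N)} (hDo : IsOpen D) (hDb : Bornology.IsBounded D) (hDc : ExteriorCone N D)
    {F : Rn N → ℝ} {M : ℝ} (hM : ∀ x, |F x| ≤ M) (hFu : UniformContinuous F) {η : ℝ}
    (hη : 0 < η) : ∃ δ : ℝ, 0 < δ ∧ ∃ ε₀ : ℝ, 0 < ε₀ ∧ ∀ (ε : ℝ) (u : Rn N → ℝ), 0 < ε → ε < ε₀ →
      IsDPPSolution N p s D F ε u → ∀ x₀ ∈ frontier D, ∀ x, ‖x - x₀‖ < δ →
        |u x - F x₀| ≤ η := by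
  obtain ⟨δ, hδ, ε₀, hε₀, h⟩ := exists_boundary_bound hN hp hs hDo hDb hDc hM hFu hη
  obtain ⟨δ', hδ', ε₀', hε₀', h'⟩ := exists_boundary_bound hN hp hs hDo hDb hDc
    (F := fun z => -F z) (by simpa using hM) hFu.neg hη
  refine ⟨min δ δ', lt_min hδ hδ', min ε₀ ε₀', lt_min hε₀ hε₀', ?_⟩
  intro ε u hε hεε hu x₀ hx₀ x hx
  have h1 := h ε u hε (hεε.trans_le (min_le_left _ _)) hu x₀ hx₀ x (hx.trans_le (min_le_left _ _))
  have h2 := h' ε _ hε (hεε.trans_le (min_le_right _ _)) hu.neg x₀ hx₀ x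
    (hx.trans_le (min_le_right _ _))
  rw [abs_le]
  constructor <;> linarith

/-! ### Asymptotic equicontinuity -/

/-- Take the point of `Dᶜ` nearest to `x`: the open ball about `x` reaching up to it lies in `D`, so
it belongs to the closure of `D`. -/
theorem exists_mem_frontier_dist_le {N : ℕ} {D : Set (Rn N)} (hDo : IsOpen D) {x x' : Rn N}
    (hx : x ∈ D) (hx' : x' ∉ D) : ∃ x₀ ∈ frontier D, dist x x₀ ≤ dist x x' := by
  obtain ⟨x₀, hx₀, hd⟩ := (hDo.isClosed_compl).exists_infDist_eq_dist ⟨x', hx'⟩ x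
  refine ⟨x₀, ?_, hd ▸ infDist_le_dist_of_mem hx'⟩
  rw [hDo.frontier_eq]
  refine ⟨?_, hx₀⟩
  have hne : dist x x₀ ≠ 0 := by
    rw [dist_ne_zero]
    rintro rfl
    exact hx₀ hx
  have hsub : ball x (dist x x₀) ⊆ D := by
    intro z hz
    by_contra hzD
    have := infDist_le_dist_of_mem (x := x) (show z ∈ Dᶜ from hzD)
    rw [hd] at this
    rw [mem_ball, dist_comm] at hz
    linarith
  refine closure_mono hsub ?_
  rw [closure_ball x hne, mem_closedBall, dist_comm]

/-- The equation is translation invariant, so `u (· + k) + η` is a supersolution on `D - k`.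
Comparison on `D ∩ (D - k)` leaves only pairs with a point outside `D`: these are controlled by the
boundary estimate and the modulus of `F`. -/
theorem exists_asymptotic_modulus (hN : 2 ≤ N) (hp : 2 ≤ p) (hs : s ∈ Set.Ioo (1 / 2 : ℝ) 1)
    {D : Set (Rn N)} (hDo : IsOpen D) (hDb : Bornology.IsBounded D) (hDc : ExteriorCone N D)
    {F : Rn N → ℝ} {M : ℝ} (hM : ∀ x, |F x| ≤ M) (hFu : UniformContinuous F) {η : ℝ}
    (hη : 0 < η) : ∃ δ : ℝ, 0 < δ ∧ ∃ ε₀ : ℝ, 0 < ε₀ ∧ ∀ (ε : ℝ) (u : Rn N → ℝ), 0 < ε → ε < ε₀ →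
      IsDPPSolution N p s D F ε u → ∀ x x', dist x x' < δ → u x ≤ u x' + η := by
  obtain ⟨δ, hδ, ε₀, hε₀, h⟩ := exists_boundary_estimate hN hp hs hDo hDb hDc hM hFu (η := η / 3)
    (by positivity)
  obtain ⟨r, hr0, hr⟩ := Metric.uniformContinuous_iff.1 hFu (η / 3) (by positivity)
  refine ⟨min (δ / 2) (r / 2), by positivity, ε₀, hε₀, ?_⟩
  intro ε u hε hεε hu x x' hxx'
  obtain ⟨hxδ, hxr⟩ := lt_min_iff.1 hxx'
  have hub := hu.abs_le_of_data hN hp hs hε hDb hM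
  -- a pair of nearby points one of which lies outside the domain
  have hone : ∀ y y', dist y y' = dist x x' → y ∈ D → y' ∉ D → |u y - u y'| ≤ η := by
    intro y y' hd hy hy'
    obtain ⟨x₀, hx₀, hdist⟩ := exists_mem_frontier_dist_le hDo hy hy'
    have hd1 : dist y x₀ ≤ dist x x' := hdist.trans hd.le
    have h1 := h ε u hε hεε hu x₀ hx₀ y (by rw [← dist_eq_norm]; linarith)
    have hd2 : dist y' x₀ < r := by
      have := dist_triangle_left y' x₀ y
      linarith
    have h2 := hr hd2
    rw [Real.dist_eq] at h2
    rw [hu.eq_data y' hy']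
    have h1' := abs_le.1 h1
    have h2' := abs_lt.1 h2
    rw [abs_le]
    constructor <;> linarith [h1'.1, h1'.2, h2'.1, h2'.2]
  set k := x' - x with hk
  have hkd : ∀ v, dist v (v + k) = dist x x' := fun v => by
    rw [dist_eq_norm, dist_eq_norm, sub_add_cancel_left, hk, neg_sub]
  have hx'eq : x' = x + k := by rw [hk]; abel
  have hwm : Measurable fun v => u (v + k) := hu.measurable.comp (measurable_add_const k)
  have hcomp := le_of_le_avgOp hN hp hs hε (E := D ∩ {v | v + k ∈ D})
    (hDb.subset Set.inter_subset_left) hu.measurable (hwm.add_const η)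
    (w := fun v => u (v + k) + η) (M' := M + |η|) hub
    (fun v => (abs_add_le _ _).trans (add_le_add_left (hub _) _))
    (fun v hv => (hu.eq_avg v hv.1).le) (fun v hv => ?_) (fun v hv => ?_) x
  · rwa [← hx'eq] at hcomp
  · refine (avgOp_add_const hN hp hs hε hwm (fun v => hub _) η v).trans ?_
    rw [avgOp_comp_add, ← hu.eq_avg _ hv.2]
  · by_cases hvD : v ∈ D
    · have hvk : v + k ∉ D := fun h => hv ⟨hvD, h⟩
      have := (abs_le.1 (hone v (v + k) (hkd v) hvD hvk)).2
      linarith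
    · by_cases hvk : v + k ∈ D
      · have := (abs_le.1 (hone (v + k) v (by rw [dist_comm, hkd]) hvk hvD)).1
        linarith
      · rw [hu.eq_data v hvD, hu.eq_data _ hvk]
        have h2 := hr (show dist v (v + k) < r by rw [hkd]; linarith)
        rw [Real.dist_eq] at h2
        linarith [(abs_lt.1 h2).2]

end

noncomputable section

/-! ### Compactness -/

/-- An Arzelà–Ascoli theorem for bounded functions, not necessarily continuous, that agree off a
bounded set and are asymptotically equicontinuous. -/
theorem exists_subseq_tendstoUniformly {N : ℕ} {D : Set (Rn N)} (hDb : Bornology.IsBounded D)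
    {F : Rn N → ℝ} {M : ℝ} {u : ℕ → Rn N → ℝ} (hM : ∀ n x, |u n x| ≤ M)
    (hout : ∀ n, ∀ x ∉ D, u n x = F x)
    (hmod : ∀ η : ℝ, 0 < η → ∃ δ : ℝ, 0 < δ ∧ ∀ᶠ n in atTop, ∀ x x', dist x x' < δ →
      u n x ≤ u n x' + η) :
    ∃ k : ℕ → ℕ, StrictMono k ∧ ∃ v : Rn N → ℝ, TendstoUniformly (fun n => u (k n)) v atTop ∧
      UniformContinuous v := by
  set q := TopologicalSpace.denseSeq (Rn N) with hq
  have hqd : DenseRange q := TopologicalSpace.denseRange_denseSeq _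
  -- Compactness of the product replaces the diagonal extraction: the values along a dense sequence
  -- converge.
  have hcpt : IsCompact (Set.pi Set.univ fun _ : ℕ => Set.Icc (-M) M) :=
    isCompact_univ_pi fun _ => isCompact_Icc
  obtain ⟨a, -, k, hk, hka⟩ := hcpt.tendsto_subseq (x := fun n i => u n (q i))
    (fun n i _ => abs_le.1 (hM n _))
  have hlim : ∀ i, Tendsto (fun n => u (k n) (q i)) atTop (𝓝 (a i)) := fun i =>
    (tendsto_pi_nhds.1 hka) i
  have hmod' : ∀ η : ℝ, 0 < η → ∃ δ : ℝ, 0 < δ ∧ ∀ᶠ n in atTop, ∀ x x', dist x x' < δ →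
      |u (k n) x - u (k n) x'| ≤ η := by
    intro η hη
    obtain ⟨δ, hδ, h⟩ := hmod η hη
    refine ⟨δ, hδ, (hk.tendsto_atTop.eventually h).mono fun n hn x x' hxx => abs_le.2 ⟨?_, ?_⟩⟩
    · linarith [hn x' x (by rwa [dist_comm])]
    · linarith [hn x x' hxx]
  have hcauchy : ∀ η : ℝ, 0 < η → ∃ n₀, ∀ m ≥ n₀, ∀ n ≥ n₀, ∀ x,
      |u (k m) x - u (k n) x| ≤ 4 * η := by
    intro η hη
    obtain ⟨δ, hδ, h⟩ := hmod' η hη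
    -- Only the compact closure of `D` needs a finite net, since off `D` all the functions agree.
    obtain ⟨I, hI⟩ := (hDb.isCompact_closure).elim_finite_subcover (fun i => ball (q i) δ)
      (fun i => isOpen_ball) (fun x _ => by
        obtain ⟨i, hi⟩ := hqd.exists_dist_lt x hδ
        exact Set.mem_iUnion.2 ⟨i, hi⟩)
    have hev : ∀ᶠ n in atTop, ∀ i ∈ I, |u (k n) (q i) - a i| < η := by
      rw [Filter.eventually_all_finset]
      intro i _
      have := (Metric.tendsto_nhds.1 (hlim i)) η hη
      simpa only [Real.dist_eq] using this
    obtain ⟨n₀, hn₀⟩ := eventually_atTop.1 (h.and hev)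
    refine ⟨n₀, fun m hm n hn x => ?_⟩
    by_cases hx : x ∈ D
    · obtain ⟨i, hiI, hi⟩ := Set.mem_iUnion₂.1 (hI (subset_closure hx))
      obtain ⟨hm1, hm2⟩ := hn₀ m hm
      obtain ⟨hn1, hn2⟩ := hn₀ n hn
      have e1 := abs_le.1 (hm1 x (q i) hi)
      have e2 := abs_le.1 (hn1 x (q i) hi)
      have e3 := abs_lt.1 (hm2 i hiI)
      have e4 := abs_lt.1 (hn2 i hiI)
      rw [abs_le]
      constructor <;> linarith [e1.1, e1.2, e2.1, e2.2, e3.1, e3.2, e4.1, e4.2]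
    · rw [hout _ x hx, hout _ x hx, sub_self, abs_zero]
      positivity
  have hC : ∀ x, ∃ b, Tendsto (fun n => u (k n) x) atTop (𝓝 b) := fun x => by
    refine cauchySeq_tendsto_of_complete (Metric.cauchySeq_iff.2 fun ε hε => ?_)
    obtain ⟨n₀, h⟩ := hcauchy (ε / 5) (by positivity)
    exact ⟨n₀, fun m hm n hn => by rw [Real.dist_eq]; linarith [h m hm n hn x]⟩
  choose v hv using hC
  refine ⟨k, hk, v, ?_, ?_⟩
  · refine Metric.tendstoUniformly_iff.2 fun ε hε => ?_
    obtain ⟨n₀, h⟩ := hcauchy (ε / 5) (by positivity)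
    filter_upwards [eventually_ge_atTop n₀] with m hm x
    have h1 : Tendsto (fun n => |u (k n) x - u (k m) x|) atTop (𝓝 |v x - u (k m) x|) :=
      ((hv x).sub_const _).abs
    have h2 := le_of_tendsto h1 ((eventually_ge_atTop n₀).mono fun n hn => h n hn m hm x)
    rw [Real.dist_eq]
    linarith
  · refine Metric.uniformContinuous_iff.2 fun ε hε => ?_
    obtain ⟨δ, hδ, h⟩ := hmod' (ε / 2) (by positivity)
    refine ⟨δ, hδ, fun x x' hxx => ?_⟩
    have h1 : Tendsto (fun n => |u (k n) x - u (k n) x'|) atTop (𝓝 |v x - v x'|) :=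
      ((hv x).sub (hv x')).abs
    have h2 := le_of_tendsto h1 (h.mono fun n hn => hn x x' hxx)
    rw [Real.dist_eq]
    linarith

end

noncomputable section

/-! ### Test functions -/

/-- The derivative is `C¹`, hence Lipschitz on the compact convex ball. The constant is uniform in
the base point, as needed for expansions at moving points. -/
theorem exists_taylor_bound {N : ℕ} {φ : Rn N → ℝ} (hφ : ContDiff ℝ 2 φ) (x : Rn N) (r : ℝ) :
    ∃ C : ℝ, 0 ≤ C ∧ ∀ w ∈ closedBall x r, ∀ w' ∈ closedBall x r,
      |φ w' - φ w - ⟪gradient φ w, w' - w⟫| ≤ C * ‖w' - w‖ ^ 2 := by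
  have hd : ContDiff ℝ 1 (fderiv ℝ φ) := hφ.fderiv_right (by norm_num)
  obtain ⟨K, hK⟩ := hd.contDiffOn.exists_lipschitzOnWith one_ne_zero (convex_closedBall x r)
    (isCompact_closedBall x r)
  refine ⟨K, K.2, fun w hw w' hw' => ?_⟩
  rw [inner_gradient_left]
  have h := Convex.norm_image_sub_le_of_norm_fderiv_le' (𝕜 := ℝ) (f := φ) (x := w) (y := w')
    -- Restricting to points within `‖w' - w‖` of `w` bounds the variation of the derivative by `K *
    -- ‖w' - w‖`, which gives the quadratic error.
    (s := closedBall x r ∩ closedBall w ‖w' - w‖) (C := K * ‖w' - w‖) (φ := fderiv ℝ φ w)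
    (fun z _ => (hφ.differentiable two_ne_zero) z)
    (fun z hz => (hK.norm_sub_le hz.1 hw).trans
      (mul_le_mul_of_nonneg_left (mem_closedBall_iff_norm.1 hz.2) K.2))
    ((convex_closedBall x r).inter (convex_closedBall w _))
    ⟨hw, mem_closedBall_self (norm_nonneg _)⟩ ⟨hw', by rw [mem_closedBall_iff_norm]⟩
  rw [Real.norm_eq_abs] at h
  exact h.trans_eq (by ring)

theorem glue_of_mem {N : ℕ} {φ u : Rn N → ℝ} {x w : Rn N} {r : ℝ} (h : w ∈ closedBall x r) :
    glue φ u x r w = φ w := by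
  simp [glue, Set.indicator_of_mem h, Set.indicator_of_notMem (Set.notMem_compl_iff.2 h)]

theorem glue_of_notMem {N : ℕ} {φ u : Rn N → ℝ} {x w : Rn N} {r : ℝ} (h : w ∉ closedBall x r) :
    glue φ u x r w = u w := by
  simp [glue, Set.indicator_of_notMem h, Set.indicator_of_mem (Set.mem_compl h)]

theorem measurable_glue {N : ℕ} {φ u : Rn N → ℝ} (hφ : Measurable φ) (hu : Measurable u)
    (x : Rn N) (r : ℝ) : Measurable (glue φ u x r) :=
  (hφ.indicator measurableSet_closedBall).add (hu.indicator measurableSet_closedBall.compl)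

theorem gradient_glue {N : ℕ} {φ u : Rn N → ℝ} {x : Rn N} {r : ℝ} (hr : 0 < r) :
    gradient (glue φ u x r) x = gradient φ x := by
  refine Filter.EventuallyEq.gradient_eq ?_
  filter_upwards [closedBall_mem_nhds x hr] with w hw using glue_of_mem hw

theorem glue_neg {N : ℕ} (φ u : Rn N → ℝ) (x : Rn N) (r : ℝ) :
    glue (fun w => -φ w) (fun w => -u w) x r = fun w => -glue φ u x r w := by
  ext w
  by_cases h : w ∈ closedBall x r
  · rw [glue_of_mem h, glue_of_mem h]
  · rw [glue_of_notMem h, glue_of_notMem h]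

/-- First order expansion of a bounded function which is `C²` on a ball, up to the constant `c`. -/
theorem exists_expansion_bound {N : ℕ} {φ : Rn N → ℝ} (hφ : ContDiff ℝ 2 φ) (x : Rn N) {r : ℝ}
    (hr : 0 < r) {B : ℝ} (hB : 0 ≤ B) :
    ∃ K : ℝ, 0 ≤ K ∧ ∀ (ψ : Rn N → ℝ) (c : ℝ), (∀ w, |ψ w| ≤ B) →
      (∀ w ∈ closedBall x r, ψ w = φ w + c) → ∀ x' ∈ closedBall x (r / 2), ∀ z,
        |ψ (x' + z) - ψ x' - ⟪gradient φ x', z⟫| ≤ K * levyWeight (‖z‖ / (r / 2)) := by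
  obtain ⟨C, hC0, hC⟩ := exists_taylor_bound hφ x r
  have hgc : Continuous (fderiv ℝ φ) := hφ.continuous_fderiv two_ne_zero
  obtain ⟨G, hG⟩ := (isCompact_closedBall x r).exists_bound_of_continuousOn hgc.continuousOn
  have hG0 : 0 ≤ G := (norm_nonneg _).trans (hG x (mem_closedBall_self hr.le))
  set ρ := r / 2 with hρ
  have hρ0 : 0 < ρ := by positivity
  -- `C ρ²` is the Taylor error for jumps up to `ρ = r / 2`, which remain in the ball; `2 B + G ρ`
  -- covers longer jumps by boundedness.
  refine ⟨C * ρ ^ 2 + (2 * B + G * ρ), by positivity, fun ψ c hψB hψ x' hx' z => ?_⟩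
  have hx'r : x' ∈ closedBall x r := closedBall_subset_closedBall (by linarith) hx'
  set t := ‖z‖ / ρ with ht
  have ht0 : 0 ≤ t := by positivity
  have hzt : ‖z‖ = t * ρ := by rw [ht]; field_simp
  rcases le_total t 1 with h1 | h1
  · have hz : ‖z‖ ≤ ρ := by rw [hzt]; nlinarith
    have hxz : x' + z ∈ closedBall x r := by
      rw [mem_closedBall_iff_norm] at hx' ⊢
      have := norm_add_le (x' - x) z
      rw [show x' + z - x = x' - x + z by abel]
      linarith
    have h2 := hC x' hx'r (x' + z) hxz
    rw [add_sub_cancel_left] at h2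
    rw [hψ _ hxz, hψ _ hx'r, levyWeight_of_le_one ht0 h1, add_sub_add_right_eq_sub]
    refine h2.trans ?_
    rw [hzt, mul_pow]
    have h3 : 0 ≤ (2 * B + G * ρ) * t ^ 2 := by positivity
    linarith
  · rw [levyWeight_of_one_le h1]
    have h2 : |⟪gradient φ x', z⟫| ≤ G * (t * ρ) := by
      rw [inner_gradient_left, ← hzt]
      exact (ContinuousLinearMap.le_opNorm _ _).trans
        (mul_le_mul_of_nonneg_right (hG x' hx'r) (norm_nonneg z))
    have h3 := abs_le.1 h2
    have h4 := abs_le.1 (hψB (x' + z))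
    have h5 := abs_le.1 (hψB x')
    have h6 : 2 * B ≤ 2 * B * t := le_mul_of_one_le_right (by positivity) h1
    have h7 : 0 ≤ C * ρ ^ 2 * t := by positivity
    rw [abs_le]
    constructor <;> linarith [h3.1, h3.2, h4.1, h4.2, h5.1, h5.2]

/-- Nearly optimal points for `u n - φ` converge to the strict maximum point of `v - φ`. -/
theorem exists_approx_max {N : ℕ} {u : ℕ → Rn N → ℝ} {v φ : Rn N → ℝ}
    (huv : TendstoUniformly u v atTop) (hv : Continuous v) (hφ : Continuous φ) {M : ℝ}
    (hM : ∀ n w, |u n w| ≤ M) {x : Rn N} {r : ℝ} (hr : 0 < r) (hx : φ x = v x)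
    (hmax : ∀ z ∈ closedBall x r \ {x}, v z < φ z) {t : ℕ → ℝ} (ht : ∀ n, 0 < t n)
    (ht0 : Tendsto t atTop (𝓝 0)) :
    ∃ ξ : ℕ → Rn N, (∀ n, ξ n ∈ closedBall x r) ∧ Tendsto ξ atTop (𝓝 x) ∧
      ∀ n, ∀ w ∈ closedBall x r, u n w - φ w ≤ u n (ξ n) - φ (ξ n) + t n := by
  obtain ⟨B, hB⟩ := (isCompact_closedBall x r).exists_bound_of_continuousOn hφ.continuousOn
  have hex : ∀ n, ∃ ξ ∈ closedBall x r, ∀ w ∈ closedBall x r,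
      u n w - φ w ≤ u n ξ - φ ξ + t n := by
    intro n
    set A := (fun w => u n w - φ w) '' closedBall x r with hA
    have hne : A.Nonempty := ⟨_, x, mem_closedBall_self hr.le, rfl⟩
    have hbdd : BddAbove A := by
      refine ⟨M + B, ?_⟩
      rintro _ ⟨w, hw, rfl⟩
      have h1 := abs_le.1 (hM n w)
      have h2 := abs_le.1 (hB w hw)
      simp only
      linarith [h1.2, h2.1]
    obtain ⟨_, ⟨ξ, hξ, rfl⟩, h⟩ := exists_lt_of_lt_csSup hne (sub_lt_self (sSup A) (ht n))
    refine ⟨ξ, hξ, fun w hw => ?_⟩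
    have := le_csSup hbdd ⟨w, hw, rfl⟩
    simp only at h this
    linarith
  choose ξ hξ hξmax using hex
  refine ⟨ξ, hξ, Metric.tendsto_atTop.2 fun ρ hρ => ?_, hξmax⟩
  have hcpt : IsCompact (closedBall x r \ ball x ρ) := (isCompact_closedBall x r).diff isOpen_ball
  rcases (closedBall x r \ ball x ρ).eq_empty_or_nonempty with hemp | hne
  · refine ⟨0, fun n _ => ?_⟩
    by_contra hcon
    exact (Set.eq_empty_iff_forall_notMem.1 hemp (ξ n)) ⟨hξ n, hcon⟩
  · obtain ⟨w₀, hw₀, hmaxw⟩ := hcpt.exists_isMaxOn hne (hv.sub hφ).continuousOn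
    have hm : v w₀ - φ w₀ < 0 := by
      have : w₀ ≠ x := by
        rintro rfl
        exact hw₀.2 (mem_ball_self hρ)
      linarith [hmax w₀ ⟨hw₀.1, this⟩]
    set m := v w₀ - φ w₀ with hmdef
    -- At `ξ n` outside the small ball, `u n - φ + t n` would be below `m - m/4 - m/4 = m/2`, while
    -- at `x` the function `u n - φ` exceeds `m/4 > m/2`.
    have hev1 := Metric.tendstoUniformly_iff.1 huv (-m / 4) (by linarith)
    have hev2 : ∀ᶠ n in atTop, t n < -m / 4 := ht0.eventually_lt_const (by linarith)
    obtain ⟨n₀, hn₀⟩ := eventually_atTop.1 (hev1.and hev2)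
    refine ⟨n₀, fun n hn => ?_⟩
    obtain ⟨h1, h2⟩ := hn₀ n hn
    by_contra hcon
    have h3 : v (ξ n) - φ (ξ n) ≤ m := hmaxw ⟨hξ n, hcon⟩
    have h4 := abs_lt.1 (h1 (ξ n))
    have h5 := abs_lt.1 (h1 x)
    have h6 := hξmax n x (mem_closedBall_self hr.le)
    linarith [h4.1, h4.2, h5.1, h5.2]

/-- The lateral boundary of a cone is a null set. -/
theorem volume_cone_boundary {N : ℕ} {c : ℝ} (h0 : 0 ≤ c) (h1 : c < 1) {e : Rn N}
    (he : ‖e‖ = 1) : (volume : Measure (Rn N)) {z | ⟪e, z⟫ = c * ‖z‖} = 0 := by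
  set K : Set (Rn N) := {z | c * ‖z‖ < ⟪e, z⟫} with hK
  have hKo : IsOpen K := isOpen_lt (by fun_prop) (by fun_prop)
  -- The lateral boundary lies in the frontier of this open convex set, since its points enter the
  -- set when moved along `e`; frontiers of convex sets are null.
  have hKc : Convex ℝ K := by
    have h2 : ConvexOn ℝ Set.univ fun z : Rn N => c * ‖z‖ - ⟪e, z⟫ :=
      ((convexOn_norm convex_univ).smul h0).sub ((innerSL ℝ e).toLinearMap.concaveOn convex_univ)
    have h3 := h2.convex_lt 0
    have h4 : K = {z | z ∈ Set.univ ∧ c * ‖z‖ - ⟪e, z⟫ < 0} := by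
      ext z
      simp [hK]
    rw [h4]
    exact h3
  refine measure_mono_null (fun z hz => ?_) (hKc.addHaar_frontier (volume : Measure (Rn N)))
  have hz' : ⟪e, z⟫ = c * ‖z‖ := hz
  rw [hKo.frontier_eq]
  refine ⟨?_, fun h => ?_⟩
  · have htend : Tendsto (fun t : ℝ => z + t • e) (𝓝[>] 0) (𝓝 z) := by
      have : Continuous fun t : ℝ => z + t • e := by fun_prop
      have h := this.tendsto 0
      simp only [zero_smul, add_zero] at h
      exact h.mono_left nhdsWithin_le_nhds
    refine mem_closure_of_tendsto htend ?_
    filter_upwards [self_mem_nhdsWithin] with t ht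
    have ht' : 0 < t := ht
    have h := norm_add_le z (t • e)
    rw [norm_smul, he, Real.norm_of_nonneg ht'.le] at h
    have h4 : ⟪e, z + t • e⟫ = c * ‖z‖ + t := by
      rw [inner_add_right, hz', real_inner_smul_right, real_inner_self_eq_norm_sq, he]
      ring
    change c * ‖z + t • e‖ < ⟪e, z + t • e⟫
    rw [h4]
    nlinarith
  · have : c * ‖z‖ < ⟪e, z⟫ := h
    linarith

end

noncomputable section

variable {N : ℕ} [NeZero N] {p s : ℝ}

/-! ### Passage to the limit -/

/-- The truncated second difference integrals converge to the untruncated one. -/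
theorem tendsto_setIntegral_cone (hN : 2 ≤ N) (hp : 2 ≤ p) (hs : s ∈ Set.Ioo (1 / 2 : ℝ) 1)
    {ε : ℕ → ℝ} (hε0 : Tendsto ε atTop (𝓝 0)) {y : ℕ → Rn N} {e : Rn N}
    (hy : ∀ n, ‖y n‖ = 1) (he : ‖e‖ = 1) (hye : Tendsto y atTop (𝓝 e)) {f : ℕ → Rn N → ℝ}
    {g : Rn N → ℝ} (hf : ∀ n, Measurable (f n)) {K ρ : ℝ} (hρ : 0 < ρ)
    (hK : ∀ᶠ n in atTop, ∀ z, |f n z| ≤ K * levyWeight (‖z‖ / ρ)) {r : ℝ}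
    (hfg : ∀ z, ‖z‖ ≠ r → Tendsto (fun n => f n z) atTop (𝓝 (g z))) :
    Tendsto (fun n => ∫ z in cone N p (ε n) (y n), f n z ∂(fracMeasure N s)) atTop
      (𝓝 (∫ z in cone N p 0 e, g z ∂(fracMeasure N s))) := by
  have h1 : ∀ n, ∫ z in cone N p (ε n) (y n), f n z ∂(fracMeasure N s) =
      ∫ z, (cone N p (ε n) (y n)).indicator (f n) z ∂(fracMeasure N s) := fun n =>
    (integral_indicator (measurableSet_cone hN hp _ (hy n))).symm
  simp only [h1]
  rw [← integral_indicator (measurableSet_cone hN hp _ he)]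
  refine tendsto_integral_filter_of_dominated_convergence
    (fun z => K * levyWeight (‖z‖ / ρ)) ?_ ?_ ((integrable_levyWeight_div hs hρ).const_mul K) ?_
  · exact Eventually.of_forall fun n =>
      ((hf n).indicator (measurableSet_cone hN hp _ (hy n))).aestronglyMeasurable
  · filter_upwards [hK] with n hn
    refine Eventually.of_forall fun z => ?_
    exact (norm_indicator_le_norm_self _ _).trans (hn z)
  · have hnull1 : ∀ᵐ z : Rn N, ⟪e, z⟫ ≠ coneCos N p * ‖z‖ :=
      ae_iff.2 (by simpa using
        volume_cone_boundary (coneCos_nonneg hN hp) (coneCos_lt_one hN hp) he)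
    have hnull2 : ∀ᵐ z : Rn N, ‖z‖ ≠ r := by
      refine ae_iff.2 ?_
      have : {z : Rn N | ¬‖z‖ ≠ r} = sphere 0 r := by ext z; simp
      rw [this]
      exact Measure.addHaar_sphere volume 0 r
    filter_upwards [ae_fracMeasure (s := s) hnull1, ae_fracMeasure (s := s) hnull2] with z hz1 hz2
    have hin : Tendsto (fun n => ⟪y n, z⟫) atTop (𝓝 ⟪e, z⟫) := hye.inner tendsto_const_nhds
    rcases lt_or_gt_of_ne hz1 with h | h
    · have hnot : z ∉ cone N p 0 e := fun hz =>
        absurd ((mem_cone_iff hN hp he).1 hz).1 (not_lt.2 h.le)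
      rw [Set.indicator_of_notMem hnot]
      refine tendsto_const_nhds.congr' ?_
      filter_upwards [hin.eventually_lt_const h] with n hn
      rw [Set.indicator_of_notMem]
      exact fun hz => absurd ((mem_cone_iff hN hp (hy n)).1 hz).1 (not_lt.2 hn.le)
    · have hz0 : 0 < ‖z‖ := by
        rw [norm_pos_iff]
        rintro rfl
        simp at h
      rw [Set.indicator_of_mem ((mem_cone_iff hN hp he).2 ⟨h, hz0⟩)]
      refine (hfg z hz2).congr' ?_
      filter_upwards [hin.eventually_const_lt h, hε0.eventually_lt_const hz0] with n hn1 hn2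
      rw [Set.indicator_of_mem]
      exact (mem_cone_iff hN hp (hy n)).2 ⟨hn1, hn2⟩

theorem tendsto_rpow_zero {ε : ℕ → ℝ} (hε0 : Tendsto ε atTop (𝓝 0)) {a : ℝ} (ha : 0 < a) :
    Tendsto (fun n => ε n ^ a) atTop (𝓝 0) := by
  have := hε0.rpow_const (p := a) (Or.inr ha.le)
  rwa [Real.zero_rpow ha.ne'] at this

/-- The centered second difference, integrated over a cone, in terms of the averages. -/
theorem setIntegral_second_difference (hN : 2 ≤ N) (hp : 2 ≤ p) (hs : s ∈ Set.Ioo (1 / 2 : ℝ) 1)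
    {ε : ℝ} (hε : 0 < ε) {y : Rn N} (hy : ‖y‖ = 1) {ψ : Rn N → ℝ} (hψ : Measurable ψ) {B : ℝ}
    (hB : ∀ z, |ψ z| ≤ B) (x : Rn N) :
    ∫ z in cone N p ε y, (ψ (x + z) + ψ (x - z) - 2 * ψ x) ∂(fracMeasure N s) =
      (fracMeasure N s).real (cone N p ε y) *
        (coneAvg N p s ε ψ x y + coneAvg N p s ε ψ x (-y) - 2 * ψ x) := by
  have hny : ‖-y‖ = 1 := by rw [norm_neg, hy]
  have h1 := coneAvg_sub_const hN hp hs hε hy hψ hB x (ψ x)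
  have h2 := coneAvg_sub_const hN hp hs hε hny hψ hB x (ψ x)
  rw [real_cone hN hp hs hε hny, ← real_cone hN hp hs hε hy] at h2
  have h3 := setIntegral_cone_isometry (s := s) hN hp (LinearIsometryEquiv.neg ℝ (E := Rn N)) ε hy
    (fun z => ψ (x + z) - ψ x)
  simp only [LinearIsometryEquiv.coe_neg] at h3
  rw [h3] at h2
  have hb : ∀ w, |ψ w - ψ x| ≤ B + B := fun w => (abs_sub _ _).trans (add_le_add (hB _) (hB _))
  have i1 : IntegrableOn (fun z => ψ (x + z) - ψ x) (cone N p ε y) (fracMeasure N s) :=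
    integrableOn_cone_of_bounded hN hp hs hε hy
      ((hψ.comp (measurable_const_add x)).sub_const _) fun z => hb _
  have i2 : IntegrableOn (fun z => ψ (x + -z) - ψ x) (cone N p ε y) (fracMeasure N s) :=
    integrableOn_cone_of_bounded hN hp hs hε hy
      ((hψ.comp (measurable_const.add measurable_neg)).sub_const _) fun z => hb _
  have h4 : ∀ z, ψ (x + z) + ψ (x - z) - 2 * ψ x = (ψ (x + z) - ψ x) + (ψ (x + -z) - ψ x) := by
    intro z
    rw [sub_eq_add_neg x z]
    ring
  simp only [h4]
  rw [integral_add i1 i2, ← h1, ← h2]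
  ring

/-- The first order expansion of the averages. -/
theorem abs_coneAvg_sub_le (hN : 2 ≤ N) (hp : 2 ≤ p) (hs : s ∈ Set.Ioo (1 / 2 : ℝ) 1)
    {ε : ℝ} (hε : 0 < ε) {y : Rn N} (hy : ‖y‖ = 1) {ψ : Rn N → ℝ} (hψ : Measurable ψ) {B : ℝ}
    (hB : ∀ z, |ψ z| ≤ B) {x g : Rn N} {K ρ : ℝ} (hK0 : 0 ≤ K) (hρ : 0 < ρ)
    (hK : ∀ z, |ψ (x + z) - ψ x - ⟪g, z⟫| ≤ K * levyWeight (‖z‖ / ρ)) :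
    |(fracMeasure N s).real (cone N p ε y) * (coneAvg N p s ε ψ x y - ψ x) -
      ε / ε ^ (2 * s) * coneMean N p s * ⟪g, y⟫| ≤
        K * ∫ z : Rn N, levyWeight (‖z‖ / ρ) ∂(fracMeasure N s) := by
  have hlev := integrable_levyWeight_div (N := N) hs hρ
  have hb : ∀ w, |ψ w - ψ x| ≤ B + B := fun w => (abs_sub _ _).trans (add_le_add (hB _) (hB _))
  have i1 : IntegrableOn (fun z => ψ (x + z) - ψ x) (cone N p ε y) (fracMeasure N s) :=
    integrableOn_cone_of_bounded hN hp hs hε hy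
      ((hψ.comp (measurable_const_add x)).sub_const _) fun z => hb _
  have i2 := integrableOn_inner_cone (p := p) hN hp hs hε hy g
  rw [coneAvg_sub_const hN hp hs hε hy hψ hB, ← integral_inner_cone hN hp hs hε hy,
    ← integral_sub i1 i2, ← integral_const_mul, ← Real.norm_eq_abs]
  refine (norm_integral_le_of_norm_le (hlev.integrableOn.const_mul K)
    (Eventually.of_forall fun z => ?_)).trans ?_
  · exact hK z
  · refine setIntegral_le_integral (hlev.const_mul K) (Eventually.of_forall fun z => ?_)
    exact mul_nonneg hK0 (levyWeight_nonneg (by positivity))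

/-- Nearly optimal directions converge to the direction of the gradient. -/
theorem tendsto_of_inner_sub_le {N : ℕ} {y g : ℕ → Rn N} {g₀ : Rn N} (hg₀ : g₀ ≠ 0)
    (hy : ∀ n, ‖y n‖ = 1) (hg : Tendsto g atTop (𝓝 g₀)) {a : ℕ → ℝ}
    (ha : Tendsto a atTop (𝓝 0)) (h : ∀ᶠ n in atTop, ⟪g n, ‖g₀‖⁻¹ • g₀ - y n⟫ ≤ a n) :
    Tendsto y atTop (𝓝 (‖g₀‖⁻¹ • g₀)) := by
  have hn0 : 0 < ‖g₀‖ := norm_pos_iff.2 hg₀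
  set e := ‖g₀‖⁻¹ • g₀ with he
  have he1 : ‖e‖ = 1 := by rw [he, norm_smul, norm_inv, norm_norm, inv_mul_cancel₀ hn0.ne']
  have hge : g₀ = ‖g₀‖ • e := by rw [he, smul_inv_smul₀ hn0.ne']
  -- For unit vectors `‖y - e‖² = 2 (1 - ⟪e, y⟫)`, and `⟪g₀, e - y⟫ = ‖g₀‖ (1 - ⟪e, y⟫)`.
  have hsq : Tendsto (fun n => ‖y n - e‖ ^ 2) atTop (𝓝 0) := by
    have hb : Tendsto (fun n => 2 / ‖g₀‖ * (a n + ‖g n - g₀‖ * 2)) atTop (𝓝 0) := by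
      have h1 : Tendsto (fun n => ‖g n - g₀‖) atTop (𝓝 0) := by
        have := (hg.sub_const g₀).norm
        rwa [sub_self, norm_zero] at this
      have h2 := (ha.add (h1.mul_const 2)).const_mul (2 / ‖g₀‖)
      simpa using h2
    refine squeeze_zero' (Eventually.of_forall fun n => sq_nonneg _) ?_ hb
    filter_upwards [h] with n hn
    have h1 : ‖y n - e‖ ^ 2 = 2 - 2 * ⟪e, y n⟫ := by
      rw [norm_sub_sq_real, hy n, he1, real_inner_comm]
      ring
    have h2 : ⟪g₀, e - y n⟫ = ‖g₀‖ * (1 - ⟪e, y n⟫) := by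
      conv_lhs => rw [hge]
      rw [real_inner_smul_left, inner_sub_right, real_inner_self_eq_norm_sq, he1]
      ring
    have h3 : ⟪g₀, e - y n⟫ = ⟪g n, e - y n⟫ - ⟪g n - g₀, e - y n⟫ := by
      rw [← inner_sub_left, sub_sub_cancel]
    have h4 : ‖e - y n‖ ≤ 2 := by
      have := norm_sub_le e (y n)
      rw [he1, hy n] at this
      linarith
    have h5 : -(‖g n - g₀‖ * 2) ≤ ⟪g n - g₀, e - y n⟫ := by
      have h6 := (abs_le.1 (abs_real_inner_le_norm (g n - g₀) (e - y n))).1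
      have h7 := mul_le_mul_of_nonneg_left h4 (norm_nonneg (g n - g₀))
      linarith
    rw [h1, div_mul_eq_mul_div, le_div_iff₀ hn0]
    linarith
  have hnorm : Tendsto (fun n => ‖y n - e‖) atTop (𝓝 0) := by
    have := hsq.sqrt
    simpa [Real.sqrt_sq] using this
  exact tendsto_iff_norm_sub_tendsto_zero.2 hnorm

/-- Uniform limits of subsolutions of the dynamic programming principles are viscosity
subsolutions. -/
theorem fracOp_glue_nonneg (hN : 2 ≤ N) (hp : 2 ≤ p) (hs : s ∈ Set.Ioo (1 / 2 : ℝ) 1)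
    {ε : ℕ → ℝ} (hε : ∀ n, 0 < ε n) (hε0 : Tendsto ε atTop (𝓝 0)) {D : Set (Rn N)}
    (hDo : IsOpen D) {u : ℕ → Rn N → ℝ} {M : ℝ} (hum : ∀ n, Measurable (u n))
    (hM : ∀ n w, |u n w| ≤ M) (hsub : ∀ n, ∀ w ∈ D, u n w ≤ avgOp N p s (ε n) (u n) w)
    {v : Rn N → ℝ} (huv : TendstoUniformly u v atTop) (hv : Continuous v) {x : Rn N} (hxD : x ∈ D)
    {r : ℝ} (hr : 0 < r) {φ : Rn N → ℝ} (hφ : ContDiff ℝ 2 φ) (hx : φ x = v x)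
    (hgrad : gradient φ x ≠ 0) (hmax : ∀ z ∈ closedBall x r \ {x}, v z < φ z) :
    0 ≤ fracOp N p s (glue φ v x r) x := by
  have hs0 : 0 < s := by linarith [hs.1]
  have hφc : Continuous φ := hφ.continuous
  -- The slack is later multiplied by the cone mass, of order `ε^{-2s}`; since `2s < 2`, a slack of
  -- `ε²` disappears in the limit.
  set t : ℕ → ℝ := fun n => ε n ^ (2 : ℝ) with ht
  have htpos : ∀ n, 0 < t n := fun n => Real.rpow_pos_of_pos (hε n) _
  have ht0 : Tendsto t atTop (𝓝 0) := tendsto_rpow_zero hε0 two_pos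
  obtain ⟨ξ, hξr, hξx, hξmax⟩ := exists_approx_max huv hv hφc hM hr hx hmax htpos ht0
  obtain ⟨B₀, hB₀⟩ := (isCompact_closedBall x r).exists_bound_of_continuousOn hφc.continuousOn
  have hB₀0 : 0 ≤ B₀ := (norm_nonneg _).trans (hB₀ x (mem_closedBall_self hr.le))
  have hM0 : 0 ≤ M := (abs_nonneg _).trans (hM 0 x)
  set c : ℕ → ℝ := fun n => u n (ξ n) - φ (ξ n) with hc
  have hc0 : Tendsto c atTop (𝓝 0) := by
    have h1 : Tendsto (fun n => u n (ξ n)) atTop (𝓝 (v x)) :=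
      huv.tendsto_comp hv.continuousAt hξx
    have h2 := h1.sub ((hφc.tendsto x).comp hξx)
    rwa [hx, sub_self] at h2
  -- The shift by `c n` makes `ψ n` agree with `u n` at `ξ n` and stay above `u n - t n` everywhere.
  set ψ : ℕ → Rn N → ℝ := fun n => glue (fun w => φ w + c n) (u n) x r with hψ
  have hψin : ∀ n, ∀ w ∈ closedBall x r, ψ n w = φ w + c n := fun n w hw => glue_of_mem hw
  have hψout : ∀ n, ∀ w ∉ closedBall x r, ψ n w = u n w := fun n w hw => glue_of_notMem hw
  have hψm : ∀ n, Measurable (ψ n) := fun n =>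
    measurable_glue (hφc.measurable.add_const _) (hum n) x r
  set B := 2 * B₀ + M with hB
  have hψB : ∀ n w, |ψ n w| ≤ B := fun n w => by
    by_cases hw : w ∈ closedBall x r
    · rw [hψin n w hw]
      have h1 := abs_le.1 (hB₀ w hw)
      have h2 := abs_le.1 (hB₀ _ (hξr n))
      have h3 := abs_le.1 (hM n (ξ n))
      simp only [hc]
      rw [abs_le]
      constructor <;> linarith [h1.1, h1.2, h2.1, h2.2, h3.1, h3.2]
    · rw [hψout n w hw]
      linarith [hM n w]
  have huψ : ∀ n w, u n w ≤ ψ n w + t n := fun n w => by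
    by_cases hw : w ∈ closedBall x r
    · rw [hψin n w hw]
      have := hξmax n w hw
      simp only [hc]
      linarith
    · rw [hψout n w hw]
      linarith [htpos n]
  have hψξ : ∀ n, ψ n (ξ n) = u n (ξ n) := fun n => by
    rw [hψin n _ (hξr n)]
    simp only [hc]
    ring
  obtain ⟨K, hK0, hK⟩ := exists_expansion_bound hφ x hr (B := B) (by positivity)
  have hρ : 0 < r / 2 := by positivity
  have hev : ∀ᶠ n in atTop, ξ n ∈ D ∧ ξ n ∈ closedBall x (r / 2) :=
    hξx.eventually ((hDo.eventually_mem hxD).and (closedBall_mem_nhds x hρ))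
  have hyex := fun n => exists_avgOp_le (p := p) hN hp hs (hε n) (hψB n) (ξ n) (htpos n)
  choose y hy1 hy using hyex
  set e := ‖gradient φ x‖⁻¹ • gradient φ x with he
  have he1 : ‖e‖ = 1 := by
    rw [he, norm_smul, norm_inv, norm_norm, inv_mul_cancel₀ (norm_ne_zero_iff.2 hgrad)]
  set H := ∫ z : Rn N, levyWeight (‖z‖ / (r / 2)) ∂(fracMeasure N s) with hH
  set m : ℕ → ℝ := fun n => (ε n ^ (2 * s))⁻¹ * coneMass N p s with hm
  have hmreal : ∀ n (y' : Rn N), ‖y'‖ = 1 →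
      (fracMeasure N s).real (cone N p (ε n) y') = m n := fun n y' hy' =>
    real_cone hN hp hs (hε n) hy'
  have hmpos : ∀ n, 0 < m n := fun n => by
    rw [← hmreal n e he1]
    exact real_cone_pos hN hp hs (hε n) he1
  have htm0 : Tendsto (fun n => t n * m n) atTop (𝓝 0) := by
    have h1 := (tendsto_rpow_zero hε0 (a := 2 - 2 * s) (by linarith [hs.2])).mul_const
      (coneMass N p s)
    rw [zero_mul] at h1
    refine h1.congr fun n => ?_
    simp only [ht, hm]
    rw [Real.rpow_sub (hε n)]
    ring
  -- the directions
  have hgc : Continuous (gradient φ) := by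
    have : gradient φ = fun w => (InnerProductSpace.toDual ℝ (Rn N)).symm (fderiv ℝ φ w) := rfl
    rw [this]
    exact (LinearIsometryEquiv.continuous _).comp (hφ.continuous_fderiv two_ne_zero)
  have hye : Tendsto y atTop (𝓝 e) := by
    -- The total error divided by the coefficient of the gradient term, `ε^{1-2s} coneMean`; it
    -- tends to zero because `2s > 1`.
    set a : ℕ → ℝ := fun n => (2 * (K * H) + t n * m n) *
      (ε n ^ (2 * s - 1) * (coneMean N p s)⁻¹) with ha
    have ha0 : Tendsto a atTop (𝓝 0) := by
      have h1 := (tendsto_rpow_zero hε0 (a := 2 * s - 1) (by linarith [hs.1])).mul_const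
        (coneMean N p s)⁻¹
      have h2 := (htm0.const_add (2 * (K * H))).mul h1
      simpa using h2
    refine tendsto_of_inner_sub_le hgrad hy1 ((hgc.tendsto x).comp hξx) ha0 ?_
    filter_upwards [hev] with n hn
    have hexp := hK (ψ n) (c n) (hψB n) (hψin n) (ξ n) hn.2
    have h1 := (abs_le.1 (abs_coneAvg_sub_le hN hp hs (hε n) (hy1 n) (hψm n) (hψB n) hK0 hρ hexp)).2
    have h2 := (abs_le.1 (abs_coneAvg_sub_le hN hp hs (hε n) he1 (hψm n) (hψB n) hK0 hρ hexp)).1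
    rw [hmreal n _ (hy1 n)] at h1
    rw [hmreal n _ he1] at h2
    have h3 := (hy n e he1).1
    have hmean := coneMean_pos hN hp hs
    have hεs := Real.rpow_pos_of_pos (hε n) (2 * s)
    have hεn := hε n
    have h4 : a n = (2 * (K * H) + t n * m n) / (ε n / ε n ^ (2 * s) * coneMean N p s) := by
      simp only [ha]
      rw [Real.rpow_sub (hε n), Real.rpow_one]
      field_simp
    rw [h4, le_div_iff₀ (by positivity), Function.comp_apply, ← he, inner_sub_right]
    have h5 := mul_le_mul_of_nonneg_left h3 (hmpos n).le
    rw [← hH] at h1 h2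
    linarith
  -- the limit of the second differences
  have hconv : ∀ z, ‖z‖ ≠ r → Tendsto (fun n => ψ n (ξ n + z)) atTop (𝓝 (glue φ v x r (x + z))) := by
    intro z hz
    have hξz : Tendsto (fun n => ξ n + z) atTop (𝓝 (x + z)) := hξx.add_const z
    have hdist : Tendsto (fun n => dist (ξ n + z) x) atTop (𝓝 ‖z‖) := by
      have := hξz.dist (tendsto_const_nhds (x := x))
      rwa [dist_eq_norm, add_sub_cancel_left] at this
    have hdz : dist (x + z) x = ‖z‖ := by rw [dist_eq_norm, add_sub_cancel_left]
    rcases lt_or_gt_of_ne hz with h | h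
    · rw [glue_of_mem (mem_closedBall.2 (by rw [hdz]; exact h.le))]
      have h1 := ((hφc.tendsto _).comp hξz).add hc0
      rw [add_zero] at h1
      refine h1.congr' ?_
      filter_upwards [hdist.eventually_lt_const h] with n hn
      exact (hψin n _ (mem_closedBall.2 hn.le)).symm
    · rw [glue_of_notMem (fun h' => absurd (mem_closedBall.1 h') (by rw [hdz]; exact not_le.2 h))]
      refine (huv.tendsto_comp hv.continuousAt hξz).congr' ?_
      filter_upwards [hdist.eventually_const_lt h] with n hn
      exact (hψout n _ fun h' => absurd (mem_closedBall.1 h') (not_le.2 hn)).symm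
  have hconv0 : Tendsto (fun n => ψ n (ξ n)) atTop (𝓝 (glue φ v x r x)) := by
    have := hconv 0 (by rw [norm_zero]; exact hr.ne)
    simpa using this
  have hlim := tendsto_setIntegral_cone (s := s) (p := p) hN hp hs hε0 hy1 he1 hye
    (f := fun n z => ψ n (ξ n + z) + ψ n (ξ n - z) - 2 * ψ n (ξ n))
    (g := fun z => glue φ v x r (x + z) + glue φ v x r (x - z) - 2 * glue φ v x r x)
    (fun n => (((hψm n).comp (measurable_const_add _)).add
      ((hψm n).comp (measurable_const.sub measurable_id))).sub_const _)
    (K := 2 * K) hρ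
    (by
      filter_upwards [hev] with n hn z
      have h1 := abs_le.1 (hK (ψ n) (c n) (hψB n) (hψin n) (ξ n) hn.2 z)
      have h2 := abs_le.1 (hK (ψ n) (c n) (hψB n) (hψin n) (ξ n) hn.2 (-z))
      rw [inner_neg_right, norm_neg, ← sub_eq_add_neg] at h2
      rw [abs_le]
      constructor <;> linarith [h1.1, h1.2, h2.1, h2.2])
    (r := r)
    (fun z hz => by
      have h1 := hconv (-z) (by rwa [norm_neg])
      simp only [← sub_eq_add_neg] at h1
      exact ((hconv z hz).add h1).sub (hconv0.const_mul 2))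
  unfold fracOp
  rw [gradient_glue hr, ← he]
  -- Two of the three slacks come from `u n ≤ ψ n + t n`, doubled, and one from the nearly optimal
  -- direction.
  have hlow : Tendsto (fun n => -(3 * (t n * m n))) atTop (𝓝 0) := by
    simpa using (htm0.const_mul 3).neg
  refine le_of_tendsto_of_tendsto hlow hlim ?_
  filter_upwards [hev] with n hn
  rw [setIntegral_second_difference hN hp hs (hε n) (hy1 n) (hψm n) (hψB n), hmreal n _ (hy1 n)]
  have h1 := hsub n (ξ n) hn.1
  have h2 := avgOp_mono_add (p := p) hN hp hs (hε n) (hum n) (hψm n) (hM n) (hψB n) (huψ n) (ξ n)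
  have h3 := (hy n (-(y n)) (by rw [norm_neg, hy1 n])).2
  have h4 := hψξ n
  have h5 : -(3 * t n) ≤ coneAvg N p s (ε n) (ψ n) (ξ n) (y n) +
      coneAvg N p s (ε n) (ψ n) (ξ n) (-(y n)) - 2 * ψ n (ξ n) := by linarith
  have h6 := mul_le_mul_of_nonneg_left h5 (hmpos n).le
  linarith

/-- Negation reverses the gradient and hence the cone, but the integrand is even in `z`, so the
reflected cone gives the same integral up to sign. -/
theorem fracOp_neg (hN : 2 ≤ N) (hp : 2 ≤ p) {f : Rn N → ℝ} {x : Rn N} (hf : gradient f x ≠ 0) :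
    fracOp N p s (fun w => -f w) x = -fracOp N p s f x := by
  have hg : gradient (fun w => -f w) x = -gradient f x := by
    have h1 : DifferentiableAt ℝ f x := by
      by_contra h
      exact hf (gradient_eq_zero_of_not_differentiableAt h)
    unfold gradient
    rw [fderiv_fun_neg, map_neg]
  have he : ‖‖gradient f x‖⁻¹ • gradient f x‖ = 1 := by
    rw [norm_smul, norm_inv, norm_norm, inv_mul_cancel₀ (norm_ne_zero_iff.2 hf)]
  unfold fracOp
  rw [hg, norm_neg, smul_neg]
  have h := setIntegral_cone_isometry (s := s) hN hp (LinearIsometryEquiv.neg ℝ (E := Rn N)) 0 he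
    (fun z => -f (x + z) + -f (x - z) - 2 * -f x)
  simp only [LinearIsometryEquiv.coe_neg] at h
  rw [h, ← integral_neg]
  refine integral_congr_ae (Eventually.of_forall fun z => ?_)
  simp only [sub_neg_eq_add, ← sub_eq_add_neg x z]
  ring

/-- Nonnegativity of the constant suffices, because both viscosity conditions only concern a sign.
-/
theorem fracPLaplacian_factor_nonneg (hN : 2 ≤ N) (hp : 2 ≤ p) (hs : s ∈ Set.Ioo (1 / 2 : ℝ) 1) :
    0 ≤ (2 - 2 * s) / fracConst N s *
      ((N + p - 2) / (surf N).real (cup N (coneAngle N p))) := by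
  have h1 := fracConst_pos (N := N) (by linarith [hs.1] : 0 < s) hs.2
  have h2 : (2 : ℝ) ≤ N := by exact_mod_cast hN
  have h3 : 0 ≤ 2 - 2 * s := by linarith [hs.2]
  have h4 : 0 ≤ (N : ℝ) + p - 2 := by linarith
  positivity

end

end GeomPLaplace

/-! ### Conclusion -/

theorem mainTheorem1 (N : ℕ) [NeZero N] (hN : 2 ≤ N) (p s : ℝ) (hp : 2 ≤ p)
    (hs : s ∈ Set.Ioo (1 / 2 : ℝ) 1)
    (D : Set (GeomPLaplace.Rn N)) (hDo : IsOpen D) (hDb : Bornology.IsBounded D)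
    (hDc : GeomPLaplace.ExteriorCone N D)
    (F : GeomPLaplace.Rn N → ℝ) (hFb : ∃ M : ℝ, ∀ x, |F x| ≤ M) (hFu : UniformContinuous F)
    (ε : ℕ → ℝ) (hε : ∀ n, 0 < ε n) (hε0 : Filter.Tendsto ε Filter.atTop (nhds 0))
    (u : ℕ → GeomPLaplace.Rn N → ℝ)
    (hu : ∀ n, GeomPLaplace.IsDPPSolution N p s D F (ε n) (u n)) :
    ∃ k : ℕ → ℕ, StrictMono k ∧ ∃ v : GeomPLaplace.Rn N → ℝ,
      TendstoUniformly (fun n => u (k n)) v Filter.atTop ∧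
      GeomPLaplace.IsViscositySolution N p s D F v := by
  obtain ⟨M, hM⟩ := hFb
  have hub : ∀ n x, |u n x| ≤ M := fun n => (hu n).abs_le_of_data hN hp hs (hε n) hDb hM
  obtain ⟨k, hk, v, hkv, hvu⟩ := GeomPLaplace.exists_subseq_tendstoUniformly hDb hub
    (fun n => (hu n).eq_data) fun η hη => by
      obtain ⟨δ, hδ, ε₀, hε₀, h⟩ :=
        GeomPLaplace.exists_asymptotic_modulus hN hp hs hDo hDb hDc hM hFu hη
      exact ⟨δ, hδ, (hε0.eventually_lt_const hε₀).mono fun n hn => h _ _ (hε n) hn (hu n)⟩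
  have hlim : ∀ x, Tendsto (fun n => u (k n) x) atTop (𝓝 (v x)) := fun x => hkv.tendsto_at x
  have hεk : Tendsto (fun n => ε (k n)) atTop (𝓝 0) := hε0.comp hk.tendsto_atTop
  have hfac := GeomPLaplace.fracPLaplacian_factor_nonneg hN hp hs
  refine ⟨k, hk, v, hkv, ?_, hvu, ?_, ?_, ?_⟩
  · exact ⟨M, fun x => le_of_tendsto (hlim x).abs (Eventually.of_forall fun n => hub _ x)⟩
  · intro x hx
    refine tendsto_nhds_unique (hlim x) (tendsto_const_nhds.congr fun n => ?_)
    exact ((hu (k n)).eq_data x hx).symm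
  · intro x hx r hr φ hφ hφx hgrad hmax
    exact mul_nonneg hfac (GeomPLaplace.fracOp_glue_nonneg hN hp hs (fun n => hε (k n)) hεk hDo
      (fun n => (hu (k n)).measurable) (fun n => hub (k n))
      (fun n w hw => ((hu (k n)).eq_avg w hw).le) hkv hvu.continuous hx hr hφ hφx hgrad hmax)
  -- The supersolution property is the subsolution property of `-v`, the limit of the solutions `-u
  -- (k n)` with data `-F`.
  · intro x hx r hr φ hφ hφx hgrad hmin
    have hgneg : gradient (fun w => -φ w) x ≠ 0 := by
      unfold gradient at hgrad ⊢
      rw [fderiv_fun_neg, map_neg]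
      exact neg_ne_zero.2 hgrad
    have h := GeomPLaplace.fracOp_glue_nonneg hN hp hs (fun n => hε (k n)) hεk hDo
      (fun n => (hu (k n)).neg.measurable) (M := M) (fun n w => by rw [abs_neg]; exact hub _ _)
      (fun n w hw => ((hu (k n)).neg.eq_avg w hw).le) (v := fun w => -v w)
      (hkv.neg) hvu.continuous.neg hx hr hφ.neg (by rw [hφx]) hgneg
      (fun z hz => neg_lt_neg (hmin z hz))
    rw [GeomPLaplace.glue_neg, GeomPLaplace.fracOp_neg hN hp
      (by rwa [GeomPLaplace.gradient_glue hr])] at h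
    exact mul_nonpos_of_nonneg_of_nonpos hfac (neg_nonneg.1 h)
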